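/- Let $\Gamma$ be a finite simple graph with vertex set $X$, and let $G$ be the partially commutative group (right-angled Artin group) with commutation graph $\Gamma$, that is, the group $\langle X \mid [x,y]=1 \text{ whenever } x,y \text{ are adjacent in } \Gamma\rangle$. For a subset $S$ of $G$ let $C(S)$ be its centraliser in $G$. The set $\mathfrak C(G)$ of all centralisers $C(S)$, $S\subseteq G$, ordered by inclusion, is a lattice, in which $C_1\wedge C_2=C_1\cap C_2$ and $C_1\vee C_2$ is the intersection of all centralisers that contain $C_1$ and $C_2$. The height of a lattice is the supremum of the lengths $k$ of its strict chains $C_0>C_1>\dots>C_k$, and the centraliser dimension $\mathrm{cdim}(G)$ is the height of $\mathfrak C(G)$. Let $\mathfrak C(X;G)=\{C(Y) : Y\subseteq X\}$ be the set of canonical centralisers. Theorem. The set $\mathfrak C(X;G)$ is a sublattice of $\mathfrak C(G)$, and $\mathrm{cdim}(G)$ is equal to the height of the lattice $\mathfrak C(X;G)$. This number $d=\mathrm{cdim}(G)$ is finite, and there are $x_1,\dots,x_d\in X$ with $$G>C(x_1)>C(x_1,x_2)>\dots>C(x_1,\dots,x_d)=Z(G).$$ Moreover, $d$ is the largest $k$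 for which there are $x_1,\dots,x_k\in X$ with $G>C(x_1)>\dots>C(x_1,\dots,x_k)$, and also the largest $k$ for which there are $x_1,\dots,x_k\in X$ with $$X\supsetneq \{x_1\}^\perp\supsetneq\{x_1,x_2\}^\perp\supsetneq\dots\supsetneq\{x_1,\dots,x_k\}^\perp,$$ where $Y^\perp$ is the set of the vertices $v\in X$ that are equal or adjacent to each $y\in Y$. -/

import Mathlib

/-- The commutators `[x, y] = x⁻¹ y⁻¹ x y` in the free group on the vertices, one for each pair of
adjacent vertices of the commutation graph. -/
def commutationRels {V : Type*} (Γ : SimpleGraph V) : Set (FreeGroup V) :=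
  {r | ∃ x y : V, Γ.Adj x y ∧
    r = (FreeGroup.of x)⁻¹ * (FreeGroup.of y)⁻¹ * FreeGroup.of x * FreeGroup.of y}

/-- The free partially commutative group (right-angled Artin group) with commutation graph `Γ`. -/
abbrev PCGroup {V : Type*} (Γ : SimpleGraph V) : Type _ :=
  PresentedGroup (commutationRels Γ)

/-- The canonical generator of the partially commutative group given by a vertex. -/
def PCGroup.gen {V : Type*} (Γ : SimpleGraph V) (x : V) : PCGroup Γ :=
  PresentedGroup.of x

/-- The set of all centralisers of subsets of the group `G`, ordered by inclusion. -/
abbrev CentraliserLattice (G : Type*) [Group G] : Type _ :=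
  {H : Subgroup G // ∃ S : Set G, H = Subgroup.centralizer S}

/-- The centraliser `C(S)`, as an element of the centraliser lattice. -/
def CentraliserLattice.of {G : Type*} [Group G] (S : Set G) : CentraliserLattice G :=
  ⟨Subgroup.centralizer S, S, rfl⟩

theorem centraliser_sInf {G : Type*} [Group G] (T : Set (Subgroup G))
    (hT : ∀ H ∈ T, ∃ S : Set G, H = Subgroup.centralizer S) :
    ∃ S : Set G, sInf T = Subgroup.centralizer S := by
  refine ⟨{s | ∃ S : Set G, Subgroup.centralizer S ∈ T ∧ s ∈ S}, ?_⟩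
  ext g
  simp only [Subgroup.mem_sInf, Subgroup.mem_centralizer_iff, Set.mem_ofPred_eq]
  constructor
  · rintro h s ⟨S, hS, hs⟩
    exact Subgroup.mem_centralizer_iff.1 (h _ hS) s hs
  · intro h H hH
    obtain ⟨S, rfl⟩ := hT H hH
    exact Subgroup.mem_centralizer_iff.2 fun s hs => h s ⟨S, hH, hs⟩

/-- The infimum of two centralisers is their intersection; the supremum is the intersection of all
centralisers that contain both. -/
instance CentraliserLattice.instLattice (G : Type*) [Group G] : Lattice (CentraliserLattice G) where
  toPartialOrder := inferInstance
  inf A B := ⟨A.1 ⊓ B.1, by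
    rw [← sInf_pair]
    exact centraliser_sInf _ (by rintro H (rfl | rfl); exacts [A.2, B.2])⟩
  sup A B := ⟨sInf {H | (∃ S : Set G, H = Subgroup.centralizer S) ∧ A.1 ≤ H ∧ B.1 ≤ H},
    centraliser_sInf _ fun _ h => h.1⟩
  inf_le_left A B := (inf_le_left : A.1 ⊓ B.1 ≤ A.1)
  inf_le_right A B := (inf_le_right : A.1 ⊓ B.1 ≤ B.1)
  le_inf A B C h h' := (le_inf h h' : A.1 ≤ B.1 ⊓ C.1)
  le_sup_left A B := (le_sInf fun _ h => h.2.1 : A.1 ≤ sInf _)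
  le_sup_right A B := (le_sInf fun _ h => h.2.2 : B.1 ≤ sInf _)
  sup_le A B C h h' := by
    have hC : C.1 ∈ {H : Subgroup G |
        (∃ S : Set G, H = Subgroup.centralizer S) ∧ A.1 ≤ H ∧ B.1 ≤ H} := ⟨C.2, h, h'⟩
    exact sInf_le hC

/-- The group `G` has a chain `C₀ > C₁ > ⋯ > C_k` of centralisers; its length is `k`. -/
def HasCentraliserChain (G : Type*) [Group G] (k : ℕ) : Prop :=
  ∃ C : Fin (k + 1) → CentraliserLattice G, StrictAnti C

/-- The centraliser dimension of a group: the largest length of a chain of centralisers, and `∞` if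
there is no largest length. -/
noncomputable def cdim (G : Type*) [Group G] : ℕ∞ :=
  ⨆ (k : ℕ) (_ : HasCentraliserChain G k), (k : ℕ∞)

/-- The centralisers `C(Y)` in a partially commutative group of the sets `Y` of canonical
generators. -/
def canonicalCentralisers {V : Type*} (Γ : SimpleGraph V) : Set (CentraliserLattice (PCGroup Γ)) :=
  {C | ∃ Y : Set V, C = CentraliserLattice.of (PCGroup.gen Γ '' Y)}

/-- `C(x₁, …, xᵢ)`, the centraliser of the first `i` terms of a sequence of canonical generators;
it is the whole group for `i = 0`. -/
def prefixCentraliser {V : Type*} (Γ : SimpleGraph V) {k : ℕ} (x : Fin k → V)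
    (i : Fin (k + 1)) : Subgroup (PCGroup Γ) :=
  Subgroup.centralizer {g | ∃ j : Fin k, (j : ℕ) < (i : ℕ) ∧ g = PCGroup.gen Γ (x j)}

/-- The vertices that are equal or adjacent to each of the first `i` terms of a sequence of
vertices. -/
def prefixOrthogonal {V : Type*} (Γ : SimpleGraph V) {k : ℕ} (x : Fin k → V)
    (i : Fin (k + 1)) : Set V :=
  {v | ∀ j : Fin k, (j : ℕ) < (i : ℕ) → v = x j ∨ Γ.Adj v (x j)}

/-! Write `⟨Y⟩` for `para Γ Y` and `Y^⊥` for `perp Γ Y`. Since `C(Y) = ⟨Y^⊥⟩` and the subgroups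
`⟨Y⟩` are ordered as their vertex sets (`centralizer_gen_image`, `para_le_para_iff`), canonical
chains are a matter of the graph. The substance is `RelChain.desc`: a chain of arbitrary
centralisers yields an equally long sequence of vertices whose sets `{x₁, …, xᵢ}^⊥` decrease
strictly.

This is proved for chains of subgroups `⟨Y⟩ ∩ C(S)`, by induction on `|Y|`. Take `u` in the top term
and `g` not commuting with `u` but centralised by all lower terms. Let `q` be a shortest element of
`⟨Y⟩ g ⟨Y⟩`, with support `B`. Minimality forces the lower terms, after conjugation, into `⟨Y ∩
B^⊥⟩` (`eq_of_mul_eq_mul`). If this set is smaller than `Y`, induction applies, and one vertex of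
`B` makes up for the top term. Otherwise `q` centralises `⟨Y⟩`, and `g` can be replaced by a
cyclically reduced `f ∈ ⟨Y⟩`.

Choose a vertex `s` of `f` that does not commute with all of `Y`, and let `T` be its component in
the non-commutation graph on the support of `f`. If `T = {s}`, the lower terms lie in `⟨Y ∩ {s}^⊥⟩`,
and induction applies as before. Otherwise each element of `⟨Y⟩ ∩ C(f)` is a product `a * b`, where
a nontrivial power of `a` is a power of the `T`-factor `x` of `f` and `b ∈ ⟨Y ∩ T^⊥⟩`
(`exists_mul_of_commute`). Intersecting the chain with `⟨Y ∩ T^⊥⟩` costs at most the step at which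
`x` leaves it (`RelChain.inter_perp`), while `Y ⊋ Y ∩ {s}^⊥ ⊋ Y ∩ T^⊥` gains two steps.

The facts on commutation rest on uniqueness of reduced words up to trace equivalence
(`Reduced.traceEq`). Testing this equivalence on pairs of non-commuting letters reduces commutation
of traces to free monoids (`traceEq_append_comm_iff`), and `CycRed.exists_traceEq` passes from the
group to traces. -/

namespace PCGroup

variable {V : Type*}

/-! ### Trace equivalence and reduced words -/

section Traces

open scoped Classical

/-- The formal inverse of a signed letter. -/
def opp (a : V × Bool) : V × Bool := (a.1, !a.2)

@[simp] theorem opp_opp (a : V × Bool) : opp (opp a) = a := by simp [opp]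

@[simp] theorem opp_fst (a : V × Bool) : (opp a).1 = a.1 := rfl

theorem opp_ne (a : V × Bool) : opp a ≠ a := by
  intro h
  have := congrArg Prod.snd h
  simp [opp] at this

/-- The restriction of a word to the occurrences of two letters. -/
noncomputable def restrictPair (a b : V × Bool) (w : List (V × Bool)) : List (V × Bool) :=
  w.filter fun c => c = a ∨ c = b

theorem restrictPair_append (a b : V × Bool) (u w : List (V × Bool)) :
    restrictPair a b (u ++ w) = restrictPair a b u ++ restrictPair a b w :=
  List.filter_append ..

/-- Two words over the signed vertices are trace equivalent if they have the same restriction to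
each pair of letters with non-adjacent vertices. -/
def TraceEq (Γ : SimpleGraph V) (u w : List (V × Bool)) : Prop :=
  ∀ a b : V × Bool, ¬ Γ.Adj a.1 b.1 → restrictPair a b u = restrictPair a b w

variable {Γ : SimpleGraph V} {u u' w w' : List (V × Bool)}

@[refl] theorem TraceEq.refl (w : List (V × Bool)) : TraceEq Γ w w := fun _ _ _ => rfl

theorem TraceEq.symm (h : TraceEq Γ u w) : TraceEq Γ w u := fun a b hab => (h a b hab).symm

theorem TraceEq.trans {v : List (V × Bool)} (h : TraceEq Γ u w) (h' : TraceEq Γ w v) :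
    TraceEq Γ u v := fun a b hab => (h a b hab).trans (h' a b hab)

theorem TraceEq.append (h : TraceEq Γ u u') (h' : TraceEq Γ w w') :
    TraceEq Γ (u ++ w) (u' ++ w') := fun a b hab => by
  rw [restrictPair_append, restrictPair_append, h a b hab, h' a b hab]

theorem TraceEq.cons (c : V × Bool) (h : TraceEq Γ u w) : TraceEq Γ (c :: u) (c :: w) :=
  TraceEq.append (TraceEq.refl [c]) h

theorem TraceEq.of_append_left (h : TraceEq Γ (u ++ w) (u' ++ w')) (hu : TraceEq Γ u u') :
    TraceEq Γ w w' := fun a b hab => by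
  have := h a b hab
  rw [restrictPair_append, restrictPair_append, hu a b hab] at this
  exact List.append_cancel_left this

theorem TraceEq.of_cons {c : V × Bool} (h : TraceEq Γ (c :: u) (c :: w)) : TraceEq Γ u w :=
  TraceEq.of_append_left (u := [c]) (u' := [c]) h (TraceEq.refl _)

theorem TraceEq.perm (h : TraceEq Γ u w) : u.Perm w := by
  rw [List.perm_iff_count]
  intro a
  have h1 : ∀ l : List (V × Bool), l.count a = (restrictPair a a l).length := by
    intro l
    rw [List.count_eq_countP, restrictPair, ← List.countP_eq_length_filter]
    congr 1
    ext c
    by_cases hc : c = a <;> simp [hc]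
  rw [h1, h1, h a a (Γ.irrefl)]

theorem TraceEq.length_eq (h : TraceEq Γ u w) : u.length = w.length := h.perm.length_eq

theorem restrictPair_eq_nil {a b c : V × Bool} {m : List (V × Bool)} (hab : ¬ Γ.Adj a.1 b.1)
    (hc : c = a ∨ c = b) (hm : ∀ d ∈ m, Γ.Adj d.1 c.1) : restrictPair a b m = [] := by
  rw [restrictPair, List.filter_eq_nil_iff]
  intro d hd
  have h1 := hm d hd
  simp only [decide_eq_true_eq]
  rintro (rfl | rfl) <;> rcases hc with rfl | rfl
  · exact Γ.irrefl h1
  · exact hab h1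
  · exact hab h1.symm
  · exact Γ.irrefl h1

/-- A letter commuting with all letters of a word can be moved in front of it. -/
theorem traceEq_move {c : V × Bool} {m : List (V × Bool)} (hm : ∀ d ∈ m, Γ.Adj d.1 c.1)
    (s : List (V × Bool)) : TraceEq Γ (m ++ c :: s) (c :: (m ++ s)) := by
  intro a b hab
  by_cases hc : c = a ∨ c = b
  · have h1 := restrictPair_eq_nil hab hc hm
    rw [restrictPair_append, h1, ← List.singleton_append, ← List.singleton_append (l := m ++ s),
      restrictPair_append, restrictPair_append, restrictPair_append, h1]
    rfl
  · simp [restrictPair, hc]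

/-- The first letter of a word occurs in each equivalent word, preceded by letters which commute
with it. -/
theorem TraceEq.exists_of_cons {c : V × Bool} (h : TraceEq Γ (c :: w) w') :
    ∃ m s, w' = m ++ c :: s ∧ (∀ d ∈ m, Γ.Adj d.1 c.1) ∧ TraceEq Γ w (m ++ s) := by
  have hc : c ∈ w' := h.perm.subset List.mem_cons_self
  -- The first occurrence of `c` is taken. A letter `d` before it that did not commute with `c`
  -- would make the projection to `d, c` start with a letter of `m`, not with `c`.
  obtain ⟨m, s, rfl, hcm⟩ := List.eq_append_cons_of_mem hc
  have hm : ∀ d ∈ m, Γ.Adj d.1 c.1 := by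
    intro d hd
    by_contra hdc
    have h1 := h d c hdc
    rw [restrictPair_append, restrictPair, List.filter_cons_of_pos (by simp)] at h1
    have h2 : d ∈ restrictPair d c m := by simp [restrictPair, hd]
    cases hr : restrictPair d c m with
    | nil => simp [hr] at h2
    | cons e r =>
      rw [hr, List.cons_append] at h1
      have h3 : e ∈ restrictPair d c m := by simp [hr]
      have h4 : e ∈ m := List.mem_of_mem_filter h3
      have h5 : c = e := (List.cons.inj h1).1
      exact hcm (h5 ▸ h4)
  exact ⟨m, s, rfl, hm, (h.trans (traceEq_move hm s)).of_cons⟩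

/-- A word is reduced if no equivalent word has an adjacent pair of inverse letters. -/
def Reduced (Γ : SimpleGraph V) (w : List (V × Bool)) : Prop :=
  ∀ p a s, ¬ TraceEq Γ w (p ++ a :: opp a :: s)

theorem Reduced.congr (hw : Reduced Γ w) (h : TraceEq Γ w w') : Reduced Γ w' :=
  fun p a s h' => hw p a s (h.trans h')

theorem reduced_nil : Reduced Γ ([] : List (V × Bool)) := by
  intro p a s h
  have := h.length_eq
  simp at this

theorem Reduced.of_append (h : Reduced Γ (u ++ w)) : Reduced Γ u ∧ Reduced Γ w := by
  constructor
  · intro p a s h'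
    refine h p a (s ++ w) ?_
    simpa using h'.append (TraceEq.refl w)
  · intro p a s h'
    refine h (u ++ p) a s ?_
    simpa using (TraceEq.refl u).append h'

theorem Reduced.of_cons {c : V × Bool} (h : Reduced Γ (c :: w)) : Reduced Γ w :=
  (Reduced.of_append (u := [c]) h).2

/-- In a word which is not reduced there are inverse letters, separated only by letters that
commute with them. -/
theorem TraceEq.exists_cancelling {p s : List (V × Bool)} {a : V × Bool}
    (h : TraceEq Γ w (p ++ a :: opp a :: s)) :
    ∃ p' m s', w = p' ++ a :: (m ++ opp a :: s') ∧ ∀ d ∈ m, Γ.Adj d.1 a.1 := by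
  induction p generalizing w with
  | nil =>
    obtain ⟨m, s₁, rfl, hm, h₁⟩ := h.symm.exists_of_cons
    obtain ⟨m₂, s₂, h₂, hm₂, -⟩ := h₁.exists_of_cons
    simp only [opp_fst] at hm₂
    rw [List.append_eq_append_iff] at h₂
    rcases h₂ with ⟨r, rfl, hr⟩ | ⟨r, hr, hr'⟩
    · exact ⟨m, r, s₂, by simp [hr], fun d hd => hm₂ d (by simp [hd])⟩
    · cases r with
      | nil => exact ⟨m, [], s₂, by simp_all, by simp⟩
      | cons e r =>
        obtain ⟨rfl, -⟩ := List.cons.inj hr'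
        exact absurd (hm (opp a) (by simp [hr])) (by simp)
  | cons c p ih =>
    obtain ⟨m, s₁, rfl, hm, h₁⟩ := h.symm.exists_of_cons
    obtain ⟨p', m', s', h', hm'⟩ := ih h₁.symm
    -- The cases are the positions at which `c` is put back. If it falls between `a` and its
    -- inverse, then `a` lies in `m` and so commutes with `c`.
    rw [List.append_eq_append_iff] at h'
    rcases h' with ⟨r, rfl, rfl⟩ | ⟨r, rfl, hr⟩
    · exact ⟨m ++ c :: r, m', s', by simp, hm'⟩
    · cases r with
      | nil => exact ⟨p' ++ [c], m', s', by simp_all, hm'⟩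
      | cons e r =>
        obtain ⟨rfl, hr' : m' ++ opp a :: s' = r ++ s₁⟩ := List.cons.inj hr
        rw [List.append_eq_append_iff] at hr'
        rcases hr' with ⟨t, rfl, ht⟩ | ⟨t, rfl, rfl⟩
        · cases t with
          | nil =>
            simp only [List.nil_append] at ht
            refine ⟨p', m' ++ [c], s', by simp [← ht], ?_⟩
            intro d hd
            simp only [List.mem_append, List.mem_singleton] at hd
            rcases hd with hd | rfl
            · exact hm' d hd
            · exact (hm a (by simp)).symm
          | cons e t =>
            obtain ⟨rfl, rfl⟩ := List.cons.inj ht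
            exact ⟨p', m', t ++ c :: s₁, by simp, hm'⟩
        · refine ⟨p', r ++ c :: t, s', by simp, ?_⟩
          intro d hd
          simp only [List.mem_append, List.mem_cons] at hd
          rcases hd with hd | rfl | hd
          · exact hm' d (by simp [hd])
          · exact (hm a (by simp)).symm
          · exact hm' d (by simp [hd])

theorem exists_cancelling (h : ¬ Reduced Γ w) :
    ∃ p a m s, w = p ++ a :: (m ++ opp a :: s) ∧ ∀ d ∈ m, Γ.Adj d.1 a.1 := by
  simp only [Reduced, not_forall, not_not] at h
  obtain ⟨p, a, s, h⟩ := h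
  obtain ⟨p', m, s', h'⟩ := h.exists_cancelling
  exact ⟨p', a, m, s', h'⟩

theorem not_reduced_of_cancelling {a : V × Bool} {m : List (V × Bool)}
    (hm : ∀ d ∈ m, Γ.Adj d.1 a.1) (p s : List (V × Bool)) :
    ¬ Reduced Γ (p ++ a :: (m ++ opp a :: s)) := fun h =>
  h p a (m ++ s) ((TraceEq.refl p).append ((traceEq_move (c := opp a) hm s).cons a))

/-- If a product of two reduced words is not reduced, then a final letter of the first one is
inverse to an initial letter of the second one. -/
theorem exists_cancelling_append (hu : Reduced Γ u) (hw : Reduced Γ w)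
    (h : ¬ Reduced Γ (u ++ w)) :
    ∃ a u₁ m₁ m₂ w₂, u = u₁ ++ a :: m₁ ∧ w = m₂ ++ opp a :: w₂ ∧
      (∀ d ∈ m₁, Γ.Adj d.1 a.1) ∧ ∀ d ∈ m₂, Γ.Adj d.1 a.1 := by
  obtain ⟨p, a, m, s, hp, hm⟩ := exists_cancelling h
  rw [List.append_eq_append_iff] at hp
  rcases hp with ⟨r, rfl, rfl⟩ | ⟨r, rfl, hp⟩
  · exact absurd hw (not_reduced_of_cancelling hm r s)
  · cases r with
    | nil =>
      simp only [List.nil_append] at hp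
      exact absurd hw (hp ▸ not_reduced_of_cancelling hm [] s)
    | cons e r =>
      obtain ⟨rfl, hp' : m ++ opp a :: s = r ++ w⟩ := List.cons.inj hp
      rw [List.append_eq_append_iff] at hp'
      rcases hp' with ⟨t, rfl, ht⟩ | ⟨t, rfl, rfl⟩
      · cases t with
        | nil =>
          simp only [List.nil_append] at ht
          exact ⟨a, p, m, [], s, by simp, by simp [ht], hm, by simp⟩
        | cons e t =>
          obtain ⟨rfl, rfl⟩ := List.cons.inj ht
          exact absurd hu (not_reduced_of_cancelling hm p t)
      · exact ⟨a, p, r, t, s, rfl, rfl, fun d hd => hm d (by simp [hd]),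
          fun d hd => hm d (by simp [hd])⟩

/-- Only the new letter can cancel, and its partner can be moved to the front of `w`. This dichotomy
underlies the action of letters on reduced traces. -/
theorem Reduced.cons_or (hw : Reduced Γ w) (a : V × Bool) :
    Reduced Γ (a :: w) ∨ ∃ w', TraceEq Γ w (opp a :: w') := by
  by_cases h : Reduced Γ (a :: w)
  · exact Or.inl h
  · refine Or.inr ?_
    by_cases h1 : Reduced Γ [a]
    · obtain ⟨b, u₁, m₁, m₂, w₂, h₁, rfl, -, h₂⟩ :=
        exists_cancelling_append (u := [a]) h1 hw h
      have : a = b := by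
        cases u₁ with
        | nil => exact (List.cons.inj h₁).1
        | cons e u => simp at h₁
      subst this
      exact ⟨m₂ ++ w₂, traceEq_move (c := opp a) h₂ w₂⟩
    · obtain ⟨p, b, m, s, h2, -⟩ := exists_cancelling h1
      have := congrArg List.length h2
      simp at this
      omega

end Traces

end PCGroup

namespace PCGroup

variable {V : Type*}

/-! ### Uniqueness of reduced words, and the length function -/

section NormalForm

open scoped Classical

variable (Γ : SimpleGraph V)

theorem commute_gen {x y : V} (h : Γ.Adj x y) : Commute (gen Γ x) (gen Γ y) := by
  have h1 : (gen Γ x)⁻¹ * (gen Γ y)⁻¹ * gen Γ x * gen Γ y = 1 :=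
    PresentedGroup.one_of_mem (rels := commutationRels Γ) ⟨x, y, h, rfl⟩
  rw [mul_assoc] at h1
  simpa [Commute, SemiconjBy] using eq_inv_of_mul_eq_one_right h1

/-- The group element given by a signed vertex. -/
def letter (a : V × Bool) : PCGroup Γ := if a.2 then gen Γ a.1 else (gen Γ a.1)⁻¹

theorem letter_opp (a : V × Bool) : letter Γ (opp a) = (letter Γ a)⁻¹ := by
  rcases a with ⟨x, _ | _⟩ <;> simp [letter, opp]

theorem commute_letter {a b : V × Bool} (h : Γ.Adj a.1 b.1) :
    Commute (letter Γ a) (letter Γ b) := by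
  have := commute_gen Γ h
  rcases a with ⟨x, _ | _⟩ <;> rcases b with ⟨y, _ | _⟩ <;> simpa [letter] using this

/-- The group element represented by a word. -/
def ev (w : List (V × Bool)) : PCGroup Γ := (w.map (letter Γ)).prod

@[simp] theorem ev_nil : ev Γ [] = 1 := rfl

@[simp] theorem ev_cons (a : V × Bool) (w : List (V × Bool)) :
    ev Γ (a :: w) = letter Γ a * ev Γ w := by simp [ev]

@[simp] theorem ev_append (u w : List (V × Bool)) : ev Γ (u ++ w) = ev Γ u * ev Γ w := by
  simp [ev]

theorem ev_reverse_map_opp (w : List (V × Bool)) :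
    ev Γ (w.map opp).reverse = (ev Γ w)⁻¹ := by
  induction w with
  | nil => simp
  | cons a w ih => rw [List.map_cons, List.reverse_cons, ev_append, ih]; simp [letter_opp]

variable {Γ}

theorem commute_letter_ev {a : V × Bool} {m : List (V × Bool)} (hm : ∀ d ∈ m, Γ.Adj d.1 a.1) :
    Commute (letter Γ a) (ev Γ m) := by
  induction m with
  | nil => simp
  | cons d m ih =>
    rw [ev_cons]
    exact (commute_letter Γ (hm d (by simp)).symm).mul_right (ih fun e he => hm e (by simp [he]))

theorem TraceEq.ev_eq {u w : List (V × Bool)} (h : TraceEq Γ u w) : ev Γ u = ev Γ w := by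
  induction u generalizing w with
  | nil => rw [List.eq_nil_of_length_eq_zero h.length_eq.symm]
  | cons c u ih =>
    obtain ⟨m, s, rfl, hm, h'⟩ := h.exists_of_cons
    rw [ev_cons, ih h', ev_append, ev_append, ev_cons, ← mul_assoc, ← mul_assoc,
      (commute_letter_ev hm).eq]

theorem ev_cancelling {a : V × Bool} {m : List (V × Bool)} (hm : ∀ d ∈ m, Γ.Adj d.1 a.1)
    (s : List (V × Bool)) : ev Γ (a :: (m ++ opp a :: s)) = ev Γ (m ++ s) := by
  simp only [ev_cons, ev_append, letter_opp]
  rw [← mul_assoc, (commute_letter_ev hm).eq]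
  group

theorem exists_reduced (w : List (V × Bool)) :
    ∃ w', Reduced Γ w' ∧ ev Γ w' = ev Γ w ∧ w' ⊆ w ∧ w'.length ≤ w.length := by
  induction hn : w.length using Nat.strong_induction_on generalizing w with
  | _ n ih =>
    by_cases hw : Reduced Γ w
    · exact ⟨w, hw, rfl, fun _ h => h, hn.le⟩
    · obtain ⟨p, a, m, s, rfl, hm⟩ := exists_cancelling hw
      obtain ⟨w', h1, h2, h3, h4⟩ := ih (p ++ (m ++ s)).length (by simp at hn ⊢; omega) _ rfl
      refine ⟨w', h1, ?_, fun c hc => ?_, h4.trans (by simp at hn ⊢; omega)⟩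
      · rw [h2, ev_append, ev_append _ p, ev_cancelling hm]
      · have := h3 hc
        simp only [List.mem_append, List.mem_cons] at this ⊢
        tauto

variable (Γ)

/-- Reduced words, up to trace equivalence. -/
instance reducedSetoid : Setoid {w : List (V × Bool) // Reduced Γ w} where
  r u w := TraceEq Γ u.1 w.1
  iseqv := ⟨fun _ => .refl _, fun h => h.symm, fun h h' => h.trans h'⟩

/-- The set of reduced traces. -/
abbrev ReducedTrace : Type _ := Quotient (reducedSetoid Γ)

variable {Γ}

/-- The reduced trace of a reduced word. -/
def redTrace (w : List (V × Bool)) (hw : Reduced Γ w) : ReducedTrace Γ := ⟦⟨w, hw⟩⟧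

theorem redTrace_eq_iff {u w : List (V × Bool)} {hu : Reduced Γ u} {hw : Reduced Γ w} :
    redTrace u hu = redTrace w hw ↔ TraceEq Γ u w := Quotient.eq

theorem exists_redTrace (t : ReducedTrace Γ) : ∃ w hw, redTrace w hw = t := by
  obtain ⟨⟨w, hw⟩, rfl⟩ := Quotient.exists_rep t
  exact ⟨w, hw, rfl⟩

/-- Both clauses range over all representatives, so the chosen map needs no separate proof of
well-definedness. The clauses cannot conflict, as a reduced word would then be equivalent to one
containing a letter next to its inverse. -/
theorem exists_letterAct (a : V × Bool) (t : ReducedTrace Γ) : ∃ t' : ReducedTrace Γ,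
    (∀ w (hw : Reduced Γ w) (haw : Reduced Γ (a :: w)), t = redTrace w hw →
      t' = redTrace (a :: w) haw) ∧
    ∀ w (hw : Reduced Γ w) (haw : Reduced Γ (opp a :: w)), t = redTrace (opp a :: w) haw →
      t' = redTrace w hw := by
  obtain ⟨w, hw, rfl⟩ := exists_redTrace t
  rcases hw.cons_or a with h | ⟨w', h⟩
  · refine ⟨redTrace (a :: w) h, fun u hu hau hwu => ?_, fun u hu hau hwu => ?_⟩
    · exact redTrace_eq_iff.2 ((redTrace_eq_iff.1 hwu).cons a)
    · exact absurd ((redTrace_eq_iff.1 hwu).cons a) (h [] a u)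
  · have hw' : Reduced Γ (opp a :: w') := hw.congr h
    refine ⟨redTrace w' hw'.of_cons, fun u hu hau hwu => ?_, fun u hu hau hwu => ?_⟩
    · exact absurd (((redTrace_eq_iff.1 hwu).symm.trans h).cons a) (hau [] a w')
    · exact redTrace_eq_iff.2 (h.symm.trans (redTrace_eq_iff.1 hwu)).of_cons

/-- The action of a signed letter on reduced traces by multiplication from the left. -/
noncomputable def letterAct (a : V × Bool) (t : ReducedTrace Γ) : ReducedTrace Γ :=
  (exists_letterAct a t).choose

theorem letterAct_of_reduced {a : V × Bool} {w : List (V × Bool)} (hw : Reduced Γ w)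
    (haw : Reduced Γ (a :: w)) : letterAct a (redTrace w hw) = redTrace (a :: w) haw :=
  (exists_letterAct a _).choose_spec.1 w hw haw rfl

theorem letterAct_of_cancel {a : V × Bool} {w : List (V × Bool)} (hw : Reduced Γ w)
    (haw : Reduced Γ (opp a :: w)) : letterAct a (redTrace (opp a :: w) haw) = redTrace w hw :=
  (exists_letterAct a _).choose_spec.2 w hw haw rfl

theorem redTrace_cases (a : V × Bool) (t : ReducedTrace Γ) :
    (∃ (w : _) (hw : Reduced Γ w), Reduced Γ (a :: w) ∧ t = redTrace w hw) ∨
      ∃ (w : _) (hw : Reduced Γ (opp a :: w)), t = redTrace (opp a :: w) hw := by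
  obtain ⟨w, hw, rfl⟩ := exists_redTrace t
  rcases hw.cons_or a with h | ⟨w', h⟩
  · exact Or.inl ⟨w, hw, h, rfl⟩
  · exact Or.inr ⟨w', hw.congr h, redTrace_eq_iff.2 h⟩

theorem letterAct_opp (a : V × Bool) (t : ReducedTrace Γ) :
    letterAct (opp a) (letterAct a t) = t := by
  rcases redTrace_cases a t with ⟨w, hw, haw, rfl⟩ | ⟨w, hw, rfl⟩
  · rw [letterAct_of_reduced hw haw]
    have haw' : Reduced Γ (opp (opp a) :: w) := by rwa [opp_opp]
    have : redTrace (a :: w) haw = redTrace (opp (opp a) :: w) haw' := by simp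
    rw [this, letterAct_of_cancel hw haw']
  · rw [letterAct_of_cancel hw.of_cons, letterAct_of_reduced hw.of_cons hw]

/-- An initial letter of `b :: w` that commutes with `b` is an initial letter of `w`. -/
theorem TraceEq.exists_of_cons_cons {a b : V × Bool} {w w' : List (V × Bool)}
    (hab : Γ.Adj a.1 b.1) (h : TraceEq Γ (b :: w) (a :: w')) :
    ∃ w₂, TraceEq Γ w (a :: w₂) := by
  obtain ⟨m, s, h1, hm, -⟩ := h.symm.exists_of_cons
  cases m with
  | nil =>
    obtain ⟨rfl, -⟩ := List.cons.inj h1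
    exact absurd hab Γ.irrefl
  | cons c m =>
    obtain ⟨rfl, h2⟩ := List.cons.inj h1
    exact ⟨m ++ s, h2 ▸ traceEq_move (fun d hd => hm d (by simp [hd])) s⟩

theorem traceEq_swap {a b : V × Bool} (hab : Γ.Adj a.1 b.1) (w : List (V × Bool)) :
    TraceEq Γ (a :: b :: w) (b :: a :: w) :=
  traceEq_move (m := [a]) (by simpa using hab) w

theorem Reduced.cons_cons {a b : V × Bool} {w : List (V × Bool)} (hab : Γ.Adj a.1 b.1)
    (ha : Reduced Γ (a :: w)) (hb : Reduced Γ (b :: w)) : Reduced Γ (a :: b :: w) := by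
  rcases hb.cons_or a with h | ⟨w', h⟩
  · exact h
  · obtain ⟨w₂, h₂⟩ := h.exists_of_cons_cons (by simpa using hab)
    exact absurd (h₂.cons a) (ha [] a w₂)

/-- The defining relations act trivially because each of two adjacent letters is either added or
cancelled independently of the other. -/
theorem letterAct_comm {a b : V × Bool} (hab : Γ.Adj a.1 b.1) (t : ReducedTrace Γ) :
    letterAct a (letterAct b t) = letterAct b (letterAct a t) := by
  -- Here `b` cancels and `a` does not; the opposite case follows by exchanging the letters.
  have mixed : ∀ {a b : V × Bool}, Γ.Adj a.1 b.1 → ∀ w, Reduced Γ (opp b :: w) →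
      Reduced Γ (a :: w) → ∀ hw : Reduced Γ (opp b :: w),
      letterAct a (letterAct b (redTrace (opp b :: w) hw)) =
        letterAct b (letterAct a (redTrace (opp b :: w) hw)) := by
    intro a b hab w hbw haw hw
    have h1 : Reduced Γ (a :: opp b :: w) := haw.cons_cons (by simpa using hab) hbw
    have h2 : Reduced Γ (opp b :: a :: w) := h1.congr (traceEq_swap (by simpa using hab) w)
    rw [letterAct_of_cancel hw.of_cons, letterAct_of_reduced _ haw, letterAct_of_reduced _ h1,
      redTrace_eq_iff (hw := h2) |>.2 (traceEq_swap (by simpa using hab) w), letterAct_of_cancel haw h2]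
  rcases redTrace_cases b t with ⟨w, hw, hbw, rfl⟩ | ⟨w, hw, rfl⟩
  · rcases hw.cons_or a with haw | ⟨w', h⟩
    · have h1 := haw.cons_cons hab hbw
      have h2 := hbw.cons_cons hab.symm haw
      rw [letterAct_of_reduced hw hbw, letterAct_of_reduced hw haw, letterAct_of_reduced _ h1,
        letterAct_of_reduced _ h2]
      exact redTrace_eq_iff.2 (traceEq_swap hab w)
    · have h1 : Reduced Γ (b :: opp a :: w') := hbw.congr (h.cons b)
      have h2 := (h1.congr (traceEq_swap (by simpa using hab.symm) w')).of_cons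
      rw [redTrace_eq_iff (hw := hw.congr h) |>.2 h]
      exact (mixed hab.symm w' (hw.congr h) h2 _).symm
  · rcases hw.of_cons.cons_or a with haw | ⟨w', h⟩
    · exact mixed hab w hw haw hw
    · have h1 : Reduced Γ (opp b :: opp a :: w') := hw.congr (h.cons _)
      have hs : TraceEq Γ (opp b :: opp a :: w') (opp a :: opp b :: w') :=
        traceEq_swap (by simpa using hab.symm) w'
      have h2 := h1.congr hs
      rw [redTrace_eq_iff (hw := h1) |>.2 (h.cons (opp b)), letterAct_of_cancel h1.of_cons,
        letterAct_of_cancel h1.of_cons.of_cons, redTrace_eq_iff (hw := h2) |>.2 hs,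
        letterAct_of_cancel h2.of_cons, letterAct_of_cancel h2.of_cons.of_cons]

/-- The permutation of reduced traces given by a signed letter. -/
noncomputable def letterPerm (a : V × Bool) : Equiv.Perm (ReducedTrace Γ) where
  toFun := letterAct a
  invFun := letterAct (opp a)
  left_inv := letterAct_opp a
  right_inv t := by simpa using letterAct_opp (opp a) t

variable (Γ)

/-- The action of the group on the set of reduced traces. -/
noncomputable def traceAction : PCGroup Γ →* Equiv.Perm (ReducedTrace Γ) :=
  PresentedGroup.toGroup (f := fun x => letterPerm (x, true)) (by
    rintro r ⟨x, y, hxy, rfl⟩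
    have h : Commute (letterPerm (Γ := Γ) (x, true)) (letterPerm (y, true)) :=
      Equiv.ext fun t => letterAct_comm hxy t
    simp only [map_mul, map_inv, FreeGroup.lift_apply_of]
    rw [mul_assoc, h.eq]
    group)

theorem traceAction_letter (a : V × Bool) : traceAction Γ (letter Γ a) = letterPerm a := by
  have h : ∀ x, traceAction Γ (gen Γ x) = letterPerm (x, true) :=
    fun x => PresentedGroup.toGroup.of _
  rcases a with ⟨x, _ | _⟩
  · simp only [letter, Bool.false_eq_true, if_false, map_inv, h]
    rfl
  · simp [letter, h]

variable {Γ}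

/-- Van der Waerden's argument: the group element alone recovers the trace, from its action on the
empty one. -/
theorem traceAction_ev {w : List (V × Bool)} (hw : Reduced Γ w) :
    traceAction Γ (ev Γ w) (redTrace [] reduced_nil) = redTrace w hw := by
  induction w with
  | nil => simp
  | cons a w ih =>
    rw [ev_cons, map_mul, Equiv.Perm.mul_apply, ih hw.of_cons, traceAction_letter]
    exact letterAct_of_reduced _ hw

/-- Reduced words that represent the same element are trace equivalent. -/
theorem Reduced.traceEq {u w : List (V × Bool)} (hu : Reduced Γ u) (hw : Reduced Γ w)
    (h : ev Γ u = ev Γ w) : TraceEq Γ u w := by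
  rw [← redTrace_eq_iff (hu := hu) (hw := hw), ← traceAction_ev hu, ← traceAction_ev hw, h]

theorem exists_ev (g : PCGroup Γ) : ∃ w, ev Γ w = g := by
  let H : Subgroup (PCGroup Γ) :=
    { carrier := Set.range (ev Γ)
      mul_mem' := by
        rintro _ _ ⟨u, rfl⟩ ⟨w, rfl⟩
        exact ⟨u ++ w, by simp⟩
      one_mem' := ⟨[], rfl⟩
      inv_mem' := by
        rintro _ ⟨w, rfl⟩
        exact ⟨(w.map opp).reverse, ev_reverse_map_opp Γ w⟩ }
  exact PresentedGroup.generated_by _ H (fun x => ⟨[(x, true)], by simp [letter, gen]⟩) g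

theorem exists_reduced_ev (g : PCGroup Γ) : ∃ w, Reduced Γ w ∧ ev Γ w = g := by
  obtain ⟨w, rfl⟩ := exists_ev g
  obtain ⟨w', h, h', -⟩ := exists_reduced (Γ := Γ) w
  exact ⟨w', h, h'⟩

/-- A reduced word for a group element. -/
noncomputable def nf (g : PCGroup Γ) : List (V × Bool) := (exists_reduced_ev g).choose

theorem nf_reduced (g : PCGroup Γ) : Reduced Γ (nf g) := (exists_reduced_ev g).choose_spec.1

@[simp] theorem ev_nf (g : PCGroup Γ) : ev Γ (nf g) = g := (exists_reduced_ev g).choose_spec.2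

theorem nf_traceEq {w : List (V × Bool)} (hw : Reduced Γ w) : TraceEq Γ (nf (ev Γ w)) w :=
  (nf_reduced _).traceEq hw (ev_nf _)

/-- The length of a group element. -/
noncomputable def len (g : PCGroup Γ) : ℕ := (nf g).length

theorem Reduced.len_eq {w : List (V × Bool)} (hw : Reduced Γ w) : len (ev Γ w) = w.length :=
  (nf_traceEq hw).length_eq

theorem len_ev_le (w : List (V × Bool)) : len (ev Γ w) ≤ w.length := by
  obtain ⟨w', h, h', -, h''⟩ := exists_reduced (Γ := Γ) w
  rw [← h', h.len_eq]
  exact h''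

theorem reduced_of_length_le {w : List (V × Bool)} (h : w.length ≤ len (ev Γ w)) :
    Reduced Γ w := by
  by_contra hw
  obtain ⟨p, a, m, s, rfl, hm⟩ := exists_cancelling hw
  rw [ev_append, ev_cancelling hm, ← ev_append] at h
  have := h.trans (len_ev_le _)
  simp at this

theorem len_mul_le (g h : PCGroup Γ) : len (g * h) ≤ len g + len h := by
  have := len_ev_le (Γ := Γ) (nf g ++ nf h)
  simpa [len] using this

@[simp] theorem len_one : len (1 : PCGroup Γ) = 0 := by
  have := len_ev_le (Γ := Γ) []
  simpa using this

theorem eq_one_of_len {g : PCGroup Γ} (h : len g = 0) : g = 1 := by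
  rw [← ev_nf g, List.eq_nil_of_length_eq_zero h, ev_nil]

theorem len_inv (g : PCGroup Γ) : len g⁻¹ = len g := by
  have key : ∀ g : PCGroup Γ, len g⁻¹ ≤ len g := by
    intro g
    have h1 := len_ev_le (Γ := Γ) ((nf g).map opp).reverse
    rw [ev_reverse_map_opp, ev_nf] at h1
    simpa [len] using h1
  exact le_antisymm (key g) (by simpa using key g⁻¹)

end NormalForm

end PCGroup

namespace PCGroup

/-! ### Commutation and powers in free monoids -/

section FreeMonoid

variable {α : Type*} {u w : FreeMonoid α}

theorem freeMonoid_mul_inj_left {u' w' : FreeMonoid α} (h : u * w = u' * w')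
    (hl : u.length = u'.length) : u = u' :=
  List.append_inj_left (s₁ := u) (t₁ := w) h hl

theorem freeMonoid_length_pow (u : FreeMonoid α) (n : ℕ) : (u ^ n).length = n * u.length := by
  induction n with
  | zero => simp
  | succ n ih => rw [pow_succ, FreeMonoid.length_mul, ih]; ring

theorem freeMonoid_pow_eq_pow {p n : ℕ} (h : Commute u w) (hl : p * u.length = n * w.length) :
    u ^ p = w ^ n :=
  freeMonoid_mul_inj_left (h.pow_pow p n).eq (by simpa [freeMonoid_length_pow] using hl)

/-- Words with a common nontrivial power commute. -/
theorem freeMonoid_commute_of_pow_eq {m n : ℕ} (h : u ^ (m + 1) = w ^ (n + 1)) :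
    Commute u w := by
  have h1 : u * w * (w ^ n * u ^ m) = u ^ (m + 1) * u ^ (m + 1) := by
    calc _ = u * w ^ (n + 1) * u ^ m := by rw [pow_succ' w]; simp only [mul_assoc]
      _ = _ := by rw [← h, ← pow_succ', pow_succ' u m, pow_succ u (m + 1)]
                  rw [← pow_succ', mul_assoc, ← pow_succ']
  have h2 : w * u * (u ^ m * w ^ n) = u ^ (m + 1) * u ^ (m + 1) := by
    calc _ = w * u ^ (m + 1) * w ^ n := by rw [pow_succ' u]; simp only [mul_assoc]
      _ = w ^ (n + 1) * w ^ (n + 1) := by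
          rw [h, ← pow_succ', pow_succ' w n, pow_succ w (n + 1)]
          rw [← pow_succ', mul_assoc, ← pow_succ']
      _ = _ := by rw [h]
  exact freeMonoid_mul_inj_left (h1.trans h2.symm)
    (by simp [FreeMonoid.length_mul, add_comm])

/-- The commuting words `u ^ (q * |w|)` and `(w ^ q) ^ |u|` have the same length, hence are equal,
so `u` and `w` have a common power. -/
theorem freeMonoid_commute_of_commute_pow {q : ℕ} (hq : q ≠ 0) (h : Commute u (w ^ q)) :
    Commute u w := by
  rcases eq_or_ne u.length 0 with hu | hu
  · rw [FreeMonoid.length_eq_zero.1 hu]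
    exact Commute.one_left _
  rcases eq_or_ne w.length 0 with hw | hw
  · rw [FreeMonoid.length_eq_zero.1 hw]
    exact Commute.one_right _
  have h1 := freeMonoid_pow_eq_pow (p := q * w.length) (n := u.length) h
    (by rw [freeMonoid_length_pow]; ring)
  rw [← pow_mul] at h1
  obtain ⟨m, hm⟩ := Nat.exists_eq_succ_of_ne_zero (mul_ne_zero hq hw)
  obtain ⟨n, hn⟩ := Nat.exists_eq_succ_of_ne_zero (mul_ne_zero hq hu)
  rw [hm, hn] at h1
  exact freeMonoid_commute_of_pow_eq h1

end FreeMonoid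

/-! ### Commuting traces and their powers -/

section Powers

open scoped Classical

variable {V : Type*} {Γ : SimpleGraph V} {u w : List (V × Bool)}

/-- The power of a word. -/
def wordPow (w : List (V × Bool)) (n : ℕ) : List (V × Bool) := (List.replicate n w).flatten

@[simp] theorem wordPow_zero (w : List (V × Bool)) : wordPow w 0 = [] := rfl

theorem wordPow_succ (w : List (V × Bool)) (n : ℕ) :
    wordPow w (n + 1) = w ++ wordPow w n := by
  simp [wordPow, List.replicate_succ]

theorem mem_of_mem_wordPow {a : V × Bool} {n : ℕ} (h : a ∈ wordPow w n) : a ∈ w := by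
  simp only [wordPow, List.mem_flatten] at h
  obtain ⟨l, hl, hal⟩ := h
  rwa [List.eq_of_mem_replicate hl] at hal

@[simp] theorem length_wordPow (w : List (V × Bool)) (n : ℕ) :
    (wordPow w n).length = n * w.length := by
  simp [wordPow]

@[simp] theorem ev_wordPow (w : List (V × Bool)) (n : ℕ) : ev Γ (wordPow w n) = ev Γ w ^ n := by
  induction n with
  | zero => simp
  | succ n ih => rw [wordPow_succ, ev_append, ih, pow_succ']

theorem restrictPair_wordPow (a b : V × Bool) (w : List (V × Bool)) (n : ℕ) :
    FreeMonoid.ofList (restrictPair a b (wordPow w n)) =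
      FreeMonoid.ofList (restrictPair a b w) ^ n := by
  induction n with
  | zero => rfl
  | succ n ih => rw [wordPow_succ, restrictPair_append, FreeMonoid.ofList_append, ih, pow_succ']

/-- Projections are multiplicative, so statements about commuting traces can be checked in the free
monoids on two letters. -/
theorem traceEq_append_comm_iff : TraceEq Γ (u ++ w) (w ++ u) ↔
    ∀ a b : V × Bool, ¬ Γ.Adj a.1 b.1 →
      Commute (FreeMonoid.ofList (restrictPair a b u)) (FreeMonoid.ofList (restrictPair a b w)) := by
  simp only [TraceEq, restrictPair_append]
  rfl

theorem TraceEq.of_wordPow {q : ℕ} (hq : q ≠ 0)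
    (h : TraceEq Γ (u ++ wordPow w q) (wordPow w q ++ u)) : TraceEq Γ (u ++ w) (w ++ u) := by
  rw [traceEq_append_comm_iff] at h ⊢
  intro a b hab
  have := h a b hab
  rw [restrictPair_wordPow] at this
  exact freeMonoid_commute_of_commute_pow hq this

theorem TraceEq.filter (P : V × Bool → Bool) (h : TraceEq Γ u w) :
    TraceEq Γ (u.filter P) (w.filter P) := by
  intro a b hab
  have := congrArg (List.filter P) (h a b hab)
  simp only [restrictPair, List.filter_filter] at this ⊢
  simpa only [Bool.and_comm] using this

theorem length_restrictPair {a b : V × Bool} (hab : a ≠ b) (l : List (V × Bool)) :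
    (restrictPair a b l).length = l.count a + l.count b := by
  induction l with
  | nil => rfl
  | cons c l ih =>
    simp only [restrictPair, Bool.decide_or, List.filter_cons, List.count_cons] at ih ⊢
    by_cases h1 : c = a
    · subst h1
      simp [ih, hab]
      omega
    · by_cases h2 : c = b
      · subst h2
        simp [ih, h1]
        omega
      · simp [ih, h1, h2]

theorem length_restrictPair_self (a : V × Bool) (l : List (V × Bool)) :
    (restrictPair a a l).length = l.count a := by
  induction l with
  | nil => rfl
  | cons c l ih =>
    simp only [restrictPair, List.filter_cons, List.count_cons] at ih ⊢
    by_cases h1 : c = a <;> simp_all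

theorem count_toList_pow (a : V × Bool) (u : FreeMonoid (V × Bool)) (n : ℕ) :
    (FreeMonoid.toList (u ^ n)).count a = n * (FreeMonoid.toList u).count a := by
  induction n with
  | zero => simp
  | succ n ih => rw [pow_succ, FreeMonoid.toList_mul, List.count_append, ih]; ring

theorem count_restrictPair_left (a b : V × Bool) (l : List (V × Bool)) :
    (restrictPair a b l).count a = l.count a :=
  List.count_filter (by simp)

/-- The numbers of occurrences of two non-commuting letters in commuting traces are
proportional. -/
theorem TraceEq.count_mul_count {a b : V × Bool} (h : TraceEq Γ (u ++ w) (w ++ u))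
    (hab : ¬ Γ.Adj a.1 b.1) : u.count a * w.count b = u.count b * w.count a := by
  by_cases hne : a = b
  · rw [hne]
  have h1 := traceEq_append_comm_iff.1 h a b hab
  -- Each exponent is the length of the other projection, so the two powers have equal length and
  -- coincide; then `a` is counted in both.
  have h2 := congrArg (fun l => (FreeMonoid.toList l).count a)
    (freeMonoid_pow_eq_pow (p := w.count a + w.count b) (n := u.count a + u.count b) h1 (by
      simp only [FreeMonoid.length, FreeMonoid.toList_ofList, length_restrictPair hne]
      ring))
  simp only [count_toList_pow, FreeMonoid.toList_ofList, count_restrictPair_left] at h2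
  linarith

/-- Commuting traces in which the numbers of occurrences of each letter are in the same proportion
have a common power. -/
theorem TraceEq.wordPow_eq {p n : ℕ} (h : TraceEq Γ (u ++ w) (w ++ u))
    (hc : ∀ a, p * u.count a = n * w.count a) : TraceEq Γ (wordPow u p) (wordPow w n) := by
  intro a b hab
  apply FreeMonoid.ofList.injective
  rw [restrictPair_wordPow, restrictPair_wordPow]
  refine freeMonoid_pow_eq_pow (traceEq_append_comm_iff.1 h a b hab) ?_
  simp only [FreeMonoid.length, FreeMonoid.toList_ofList]
  by_cases hne : a = b
  · rw [hne, length_restrictPair_self, length_restrictPair_self, hc]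
  · rw [length_restrictPair hne, length_restrictPair hne, mul_add, mul_add, hc, hc]

end Powers

/-! ### Subgroups generated by sets of vertices -/

section Parabolic

open scoped Classical

variable {V : Type*} (Γ : SimpleGraph V)

/-- The subgroup generated by a set of vertices. -/
def para (Y : Set V) : Subgroup (PCGroup Γ) := Subgroup.closure (gen Γ '' Y)

/-- The vertices equal or adjacent to each vertex in a set. -/
def perp (B : Set V) : Set V := {v | ∀ b ∈ B, v = b ∨ Γ.Adj v b}

variable {Γ}

theorem ev_mem_para {Y : Set V} {w : List (V × Bool)} (h : ∀ a ∈ w, a.1 ∈ Y) :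
    ev Γ w ∈ para Γ Y := by
  induction w with
  | nil => exact one_mem _
  | cons a w ih =>
    rw [ev_cons]
    refine mul_mem ?_ (ih fun b hb => h b (by simp [hb]))
    have h1 : gen Γ a.1 ∈ para Γ Y := Subgroup.subset_closure ⟨a.1, h a (by simp), rfl⟩
    rw [letter]
    split_ifs
    exacts [h1, inv_mem h1]

theorem exists_word_of_mem_para {Y : Set V} {g : PCGroup Γ} (h : g ∈ para Γ Y) :
    ∃ w, ev Γ w = g ∧ ∀ a ∈ w, a.1 ∈ Y := by
  induction h using Subgroup.closure_induction with
  | mem g hg =>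
    obtain ⟨x, hx, rfl⟩ := hg
    exact ⟨[(x, true)], by simp [letter], by simpa⟩
  | one => exact ⟨[], by simp⟩
  | mul g h _ _ ihg ihh =>
    obtain ⟨u, rfl, hu⟩ := ihg
    obtain ⟨w, rfl, hw⟩ := ihh
    refine ⟨u ++ w, by simp, fun a ha => ?_⟩
    exact (List.mem_append.1 ha).elim (hu a) (hw a)
  | inv g _ ih =>
    obtain ⟨u, rfl, hu⟩ := ih
    refine ⟨(u.map opp).reverse, ev_reverse_map_opp Γ u, ?_⟩
    intro a ha
    simp only [List.mem_reverse, List.mem_map] at ha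
    obtain ⟨b, hb, rfl⟩ := ha
    exact hu b hb

theorem Reduced.mem_para_iff {Y : Set V} {w : List (V × Bool)} (hw : Reduced Γ w) :
    ev Γ w ∈ para Γ Y ↔ ∀ a ∈ w, a.1 ∈ Y := by
  refine ⟨fun h => ?_, ev_mem_para⟩
  obtain ⟨u, hu, huY⟩ := exists_word_of_mem_para h
  obtain ⟨u', h1, h2, h3, -⟩ := exists_reduced (Γ := Γ) u
  intro a ha
  exact huY a (h3 ((hw.traceEq h1 (by rw [h2, hu])).perm.subset ha))

theorem mem_para_iff {Y : Set V} {g : PCGroup Γ} : g ∈ para Γ Y ↔ ∀ a ∈ nf g, a.1 ∈ Y := by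
  conv_lhs => rw [← ev_nf g]
  exact (nf_reduced g).mem_para_iff

theorem reduced_singleton (a : V × Bool) : Reduced Γ [a] := by
  intro p b s h
  have := h.length_eq
  simp at this
  omega

theorem gen_mem_para_iff {Y : Set V} {x : V} : gen Γ x ∈ para Γ Y ↔ x ∈ Y := by
  have := (reduced_singleton (Γ := Γ) (x, true)).mem_para_iff (Y := Y)
  simpa [letter] using this

theorem para_le_para_iff {Y Z : Set V} : para Γ Y ≤ para Γ Z ↔ Y ⊆ Z :=
  ⟨fun h _ hx => gen_mem_para_iff.1 (h (gen_mem_para_iff.2 hx)),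
    fun h => Subgroup.closure_mono (Set.image_mono h)⟩

theorem para_inf (Y Z : Set V) : para Γ Y ⊓ para Γ Z = para Γ (Y ∩ Z) := by
  ext g
  simp only [Subgroup.mem_inf, mem_para_iff, Set.mem_inter_iff]
  exact ⟨fun h a ha => ⟨h.1 a ha, h.2 a ha⟩, fun h => ⟨fun a ha => (h a ha).1, fun a ha => (h a ha).2⟩⟩

@[simp] theorem para_univ : para Γ Set.univ = ⊤ := by
  rw [eq_top_iff]
  intro g _
  exact mem_para_iff.2 fun _ _ => Set.mem_univ _

theorem commute_of_mem_perp {B : Set V} {g h : PCGroup Γ} (hg : g ∈ para Γ B)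
    (hh : h ∈ para Γ (perp Γ B)) : Commute g h := by
  have h1 : ∀ b ∈ B, ∀ v ∈ perp Γ B, Commute (gen Γ v) (gen Γ b) := by
    intro b hb v hv
    rcases hv b hb with rfl | h
    exacts [Commute.refl _, commute_gen Γ h]
  have h2 : para Γ (perp Γ B) ≤ Subgroup.centralizer (gen Γ '' B) := by
    rw [para, Subgroup.closure_le]
    rintro _ ⟨v, hv, rfl⟩
    rw [SetLike.mem_coe, Subgroup.mem_centralizer_iff]
    rintro _ ⟨b, hb, rfl⟩
    exact (h1 b hb v hv).eq.symm
  have h3 : para Γ B ≤ Subgroup.centralizer {h} := by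
    rw [para, Subgroup.closure_le]
    rintro _ ⟨b, hb, rfl⟩
    rw [SetLike.mem_coe, Subgroup.mem_centralizer_singleton_iff]
    exact Subgroup.mem_centralizer_iff.1 (h2 hh) _ ⟨b, hb, rfl⟩
  exact Subgroup.mem_centralizer_singleton_iff.1 (h3 hg)

end Parabolic

end PCGroup

namespace PCGroup

open scoped Classical

variable {V : Type*} {Γ : SimpleGraph V}

/-! ### Cyclically reduced elements and roots -/

section CyclicallyReduced

/-- An element of a partially commutative group is cyclically reduced if its powers have the
largest possible length. -/
def CycRed (f : PCGroup Γ) : Prop := ∀ n : ℕ, len (f ^ n) = n * len f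

theorem CycRed.reduced_wordPow {f : PCGroup Γ} (hf : CycRed f) (n : ℕ) :
    Reduced Γ (wordPow (nf f) n) := by
  apply reduced_of_length_le
  rw [ev_wordPow, ev_nf, hf n, length_wordPow, len]

theorem cycRed_of_reduced {f : PCGroup Γ} {w : List (V × Bool)} (hw : ev Γ w = f)
    (h : ∀ n, Reduced Γ (wordPow w n)) : CycRed f := by
  intro n
  have h1 := (h n).len_eq
  have h2 := (h 1).len_eq
  rw [ev_wordPow, hw, length_wordPow] at h1 h2
  rw [h1, ← pow_one f, h2, one_mul]

/-- If a square of a reduced word `w` begins with an inverse of a final letter of `w`, then `w` is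
conjugate to a shorter word. -/
theorem exists_shorter_conj {w u₁ m₁ m₂ w₂ : List (V × Bool)} {a : V × Bool} {n : ℕ}
    (hw : w = u₁ ++ a :: m₁) (hw' : wordPow w n = m₂ ++ opp a :: w₂)
    (h₁ : ∀ d ∈ m₁, Γ.Adj d.1 a.1) (h₂ : ∀ d ∈ m₂, Γ.Adj d.1 a.1) :
    ∃ w', w'.length < w.length ∧ ev Γ w' = letter Γ a * ev Γ w * (letter Γ a)⁻¹ := by
  have hopp : opp a ∈ w := mem_of_mem_wordPow (n := n) (by simp [hw'])
  have hopp₂ : opp a ∉ m₂ := fun h => Γ.irrefl (v := a.1) (h₂ (opp a) h)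
  have ha₂ : a ∉ m₂ := fun h => Γ.irrefl (h₂ _ h)
  have hn : ∃ k, n = k + 1 := by
    cases n with
    | zero => simp at hw'
    | succ k => exact ⟨k, rfl⟩
  obtain ⟨k, rfl⟩ := hn
  -- The prefix `m₂` does not contain `opp a`, whereas `w` does, so the cancelling letter already
  -- lies in the first copy of `w`.
  have h3 : ∃ t, w = m₂ ++ opp a :: t := by
    rw [wordPow_succ, List.append_eq_append_iff] at hw'
    rcases hw' with ⟨r, h, -⟩ | ⟨r, h, hr⟩
    · exact absurd (h ▸ List.mem_append_left r hopp) hopp₂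
    · cases r with
      | nil => exact absurd (by simpa [h] using hopp) hopp₂
      | cons e r =>
        obtain ⟨rfl, -⟩ := List.cons.inj hr
        exact ⟨r, h⟩
  obtain ⟨t, ht⟩ := h3
  have h4 : ∃ r, w = m₂ ++ opp a :: (r ++ a :: m₁) := by
    have h5 := hw.symm.trans ht
    rw [List.append_eq_append_iff] at h5
    rcases h5 with ⟨r, h, hr⟩ | ⟨r, h, hr⟩
    · cases r with
      | nil => exact absurd (List.cons.inj hr).1.symm (opp_ne a)
      | cons e r =>
        obtain ⟨rfl, -⟩ := List.cons.inj hr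
        exact absurd (by simp [h]) ha₂
    · cases r with
      | nil => exact absurd (List.cons.inj hr).1 (opp_ne a)
      | cons e r =>
        obtain ⟨rfl, hr⟩ := List.cons.inj hr
        exact ⟨r, by rw [ht, hr]; rfl⟩
  obtain ⟨r, hr⟩ := h4
  refine ⟨m₂ ++ (r ++ m₁), ?_, ?_⟩
  · rw [hr]
    simp
  · have c₁ := commute_letter_ev h₁
    have c₂ := commute_letter_ev h₂
    rw [hr]
    simp only [ev_append, ev_cons, letter_opp]
    calc _ = ev Γ m₂ * ev Γ r * (ev Γ m₁ * letter Γ a) * (letter Γ a)⁻¹ := by group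
      _ = ev Γ m₂ * letter Γ a * (letter Γ a)⁻¹ * ev Γ r * (letter Γ a * ev Γ m₁) *
          (letter Γ a)⁻¹ := by rw [c₁.eq]; group
      _ = _ := by rw [← c₂.eq]; group

/-- A shortest conjugate by elements of `⟨Y⟩` works: a cancellation in its powers would allow
shortening it by a further letter, which again has its vertex in `Y`. -/
theorem exists_conj_cycRed {Y : Set V} {f : PCGroup Γ} (hf : f ∈ para Γ Y) :
    ∃ z ∈ para Γ Y, CycRed (z * f * z⁻¹) := by
  have hex : ∃ n, ∃ z ∈ para Γ Y, len (z * f * z⁻¹) = n := ⟨_, 1, one_mem _, rfl⟩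
  obtain ⟨z, hz, hzn⟩ := Nat.find_spec hex
  have hmin : ∀ z' ∈ para Γ Y, len (z * f * z⁻¹) ≤ len (z' * f * z'⁻¹) := by
    intro z' hz'
    rw [hzn]
    exact Nat.find_min' hex ⟨z', hz', rfl⟩
  refine ⟨z, hz, cycRed_of_reduced (ev_nf _) fun n => ?_⟩
  induction n with
  | zero => exact reduced_nil
  | succ n ih =>
    by_contra hcon
    rw [wordPow_succ] at hcon
    obtain ⟨a, u₁, m₁, m₂, w₂, h1, h2, h3, h4⟩ :=
      exists_cancelling_append (nf_reduced _) ih hcon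
    obtain ⟨w', hw', hev⟩ := exists_shorter_conj h1 h2 h3 h4
    have ha : letter Γ a ∈ para Γ Y := by
      have h5 : a.1 ∈ Y :=
        mem_para_iff.1 (mul_mem (mul_mem hz hf) (inv_mem hz)) a (by rw [h1]; simp)
      simpa using ev_mem_para (Γ := Γ) (w := [a]) (by simpa using h5)
    have h6 := hmin _ (mul_mem ha hz)
    have h7 : letter Γ a * z * f * (letter Γ a * z)⁻¹ = ev Γ w' := by
      rw [hev, ev_nf]; group
    rw [h7] at h6
    exact absurd (h6.trans (len_ev_le _)) (by simpa [len] using hw')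

/-- If `h` commutes with a power of a cyclically reduced element `f`, then the reduced word of
`h * f ^ M` commutes with that of `f` as a trace, for some `M`. -/
theorem CycRed.exists_traceEq {f h : PCGroup Γ} (hf : CycRed f) {q : ℕ} (hq : q ≠ 0)
    (hc : Commute h (f ^ q)) :
    ∃ M : ℕ, TraceEq Γ (nf (h * f ^ M) ++ nf f) (nf f ++ nf (h * f ^ M)) := by
  have hlow : ∀ M, M * len f ≤ len (h * f ^ M) + len h := by
    intro M
    have h1 := len_mul_le h⁻¹ (h * f ^ M)
    rw [inv_mul_cancel_left, hf M, len_inv] at h1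
    omega
  -- The difference `len (h * f ^ M) - M * len f` is at least `-len h`, so it has a minimum; adding
  -- `len h` keeps it in `ℕ`. At the minimum, multiplying by `f ^ q` cancels nothing.
  have hex : ∃ n, ∃ M, len (h * f ^ M) + len h = n + M * len f :=
    ⟨_, 0, (Nat.sub_add_cancel (hlow 0)).symm⟩
  obtain ⟨M, hM⟩ := Nat.find_spec hex
  have hlen : len (h * f ^ M) + q * len f ≤ len (h * f ^ M * f ^ q) := by
    obtain ⟨n, hn⟩ := Nat.exists_eq_add_of_le' (hlow (M + q))
    have h1 := Nat.find_min' hex ⟨_, hn⟩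
    rw [mul_assoc, ← pow_add]
    rw [add_mul] at hn
    omega
  refine ⟨M, TraceEq.of_wordPow hq (Reduced.traceEq ?_ ?_ ?_)⟩
  · apply reduced_of_length_le
    simpa [len] using hlen
  · apply reduced_of_length_le
    have h1 : f ^ q * (h * f ^ M) = h * f ^ M * f ^ q := by
      rw [← mul_assoc, ← hc.eq, mul_assoc, mul_assoc, ← pow_add, ← pow_add, add_comm]
    rw [ev_append, ev_wordPow, ev_nf, ev_nf, h1]
    simpa [len, add_comm] using hlen
  · rw [ev_append, ev_append, ev_wordPow, ev_nf, ev_nf, ← mul_assoc, ← hc.eq, mul_assoc, mul_assoc,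
      ← pow_add, ← pow_add, add_comm]

theorem commute_conj_iff (z g h : PCGroup Γ) :
    Commute (z * g * z⁻¹) (z * h * z⁻¹) ↔ Commute g h := by
  simp [Commute, SemiconjBy]

/-- An element that commutes with a nontrivial power of `f` commutes with `f`. -/
theorem commute_of_commute_pow {f h : PCGroup Γ} {q : ℕ} (hq : q ≠ 0)
    (hc : Commute h (f ^ q)) : Commute h f := by
  obtain ⟨z, -, hz⟩ := exists_conj_cycRed (Y := Set.univ) (f := f) (by simp)
  rw [← commute_conj_iff z]
  rw [← commute_conj_iff z, ← conj_pow] at hc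
  obtain ⟨M, hM⟩ := hz.exists_traceEq hq hc
  have h1 := hM.ev_eq
  rw [ev_append, ev_append, ev_nf, ev_nf] at h1
  have h2 : Commute (z * h * z⁻¹ * (z * f * z⁻¹) ^ M) (z * f * z⁻¹) := h1
  have h3 := h2.mul_left ((Commute.refl (z * f * z⁻¹)).pow_left M).inv_left
  rwa [mul_inv_cancel_right] at h3

theorem eq_one_of_pow_eq_one {f : PCGroup Γ} {q : ℕ} (hq : q ≠ 0) (h : f ^ q = 1) : f = 1 := by
  obtain ⟨z, -, hz⟩ := exists_conj_cycRed (Y := Set.univ) (f := f) (by simp)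
  have h1 := hz q
  rw [conj_pow, h, mul_one, mul_inv_cancel, len_one] at h1
  have h2 := eq_one_of_len ((Nat.mul_eq_zero.1 h1.symm).resolve_left hq)
  simpa using h2

end CyclicallyReduced

/-! ### Shortest elements of double cosets -/

section DoubleCosets

/-- The first letter of `u` can be brought to the front of `w ++ u'`. It cannot come from `w`, which
has no initial letter in `Y`, so it comes from `u'` and passes all of `w`. -/
theorem TraceEq.commute_of_append {Y : Set V} {u w u' : List (V × Bool)}
    (h : TraceEq Γ (u ++ w) (w ++ u')) (hu : ∀ a ∈ u, a.1 ∈ Y)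
    (hw : ∀ m a s, w = m ++ a :: s → (∀ d ∈ m, Γ.Adj d.1 a.1) → a.1 ∉ Y) :
    TraceEq Γ u u' ∧ ∀ a ∈ u, ∀ b ∈ w, Γ.Adj a.1 b.1 := by
  induction u generalizing u' with
  | nil =>
    have := h.length_eq
    simp only [List.nil_append, List.length_append, left_eq_add] at this
    rw [List.eq_nil_of_length_eq_zero this]
    exact ⟨.refl _, by simp⟩
  | cons c u ih =>
    obtain ⟨m, s, h1, hm, h2⟩ := TraceEq.exists_of_cons (w := u ++ w) h
    have key : ∀ r, m = w ++ r → u' = r ++ c :: s →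
        TraceEq Γ (c :: u) u' ∧ ∀ a ∈ c :: u, ∀ b ∈ w, Γ.Adj a.1 b.1 := by
      rintro r rfl rfl
      obtain ⟨h3, h4⟩ := ih (u' := r ++ s) (by simpa using h2) fun a ha => hu a (by simp [ha])
      refine ⟨(h3.cons c).trans (traceEq_move (fun d hd => hm d (by simp [hd])) s).symm, ?_⟩
      intro a ha b hb
      rcases List.mem_cons.1 ha with rfl | ha
      · exact (hm b (by simp [hb])).symm
      · exact h4 a ha b hb
    rw [List.append_eq_append_iff] at h1
    rcases h1 with ⟨r, hr, hr'⟩ | ⟨r, hr, hr'⟩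
    · exact key r hr hr'
    · cases r with
      | nil => exact key [] (by simpa using hr.symm) (by simpa using hr'.symm)
      | cons e r =>
        obtain ⟨rfl, -⟩ := List.cons.inj hr'
        exact absurd (hu c (by simp)) (hw m c r hr hm)

/-- By minimality no letter of `Y` can be moved to either end of `q`. Hence neither product cancels,
and the letters of `h` pass through `q` as in a trace. -/
theorem eq_of_mul_eq_mul {Y : Set V} {q : PCGroup Γ}
    (hq : ∀ p ∈ para Γ Y, ∀ r ∈ para Γ Y, len q ≤ len (p * q * r)) {h h' : PCGroup Γ}
    (hh : h ∈ para Γ Y) (hh' : h' ∈ para Γ Y) (he : h * q = q * h') :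
    h = h' ∧ ∀ a ∈ nf h, ∀ b ∈ nf q, Γ.Adj a.1 b.1 := by
  have hletter : ∀ a : V × Bool, a.1 ∈ Y → letter Γ a ∈ para Γ Y := fun a ha => by
    simpa using ev_mem_para (Γ := Γ) (w := [a]) (by simpa using ha)
  have hinit : ∀ m a s, nf q = m ++ a :: s → (∀ d ∈ m, Γ.Adj d.1 a.1) → a.1 ∉ Y := by
    intro m a s h1 hm ha
    have h2 := hq (letter Γ a)⁻¹ (inv_mem (hletter a ha)) 1 (one_mem _)
    have h3 : (letter Γ a)⁻¹ * q * 1 = ev Γ (m ++ s) := by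
      rw [← ev_nf q, h1, (traceEq_move hm s).ev_eq]
      simp
    rw [h3] at h2
    have h4 := h2.trans (len_ev_le _)
    rw [len, h1] at h4
    simp at h4
  have hfinal : ∀ u a m, nf q = u ++ a :: m → (∀ d ∈ m, Γ.Adj d.1 a.1) → a.1 ∉ Y := by
    intro u a m h1 hm ha
    have h2 := hq 1 (one_mem _) (letter Γ a)⁻¹ (inv_mem (hletter a ha))
    have h3 : 1 * q * (letter Γ a)⁻¹ = ev Γ (u ++ m) := by
      rw [← ev_nf q, h1, ev_append, ev_cons, (commute_letter_ev hm).eq]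
      simp [mul_assoc]
    rw [h3] at h2
    have h4 := h2.trans (len_ev_le _)
    rw [len, h1] at h4
    simp at h4
  have hr : Reduced Γ (nf h ++ nf q) := by
    by_contra hcon
    obtain ⟨a, u₁, m₁, m₂, w₂, h1, h2, -, h3⟩ :=
      exists_cancelling_append (nf_reduced h) (nf_reduced q) hcon
    exact hinit m₂ (opp a) w₂ h2 h3 (mem_para_iff.1 hh a (by simp [h1]))
  have hr' : Reduced Γ (nf q ++ nf h') := by
    by_contra hcon
    obtain ⟨a, u₁, m₁, m₂, w₂, h1, h2, h3, -⟩ :=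
      exists_cancelling_append (nf_reduced q) (nf_reduced h') hcon
    exact hfinal u₁ a m₁ h1 h3 (mem_para_iff.1 hh' (opp a) (by simp [h2]))
  obtain ⟨h1, h2⟩ := TraceEq.commute_of_append (hr.traceEq hr' (by simpa using he))
    (mem_para_iff.1 hh) hinit
  exact ⟨by simpa using h1.ev_eq, h2⟩

end DoubleCosets

/-! ### Factors of an element that commute with the rest of it -/

section Blocks

/-- The part of a word consisting of the letters with vertices in a given set. -/
noncomputable def part (T : Set V) (w : List (V × Bool)) : List (V × Bool) :=
  w.filter fun c => c.1 ∈ T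

theorem mem_part {T : Set V} {w : List (V × Bool)} {a : V × Bool} :
    a ∈ part T w ↔ a ∈ w ∧ a.1 ∈ T := by simp [part]

theorem part_append (T : Set V) (u w : List (V × Bool)) :
    part T (u ++ w) = part T u ++ part T w := List.filter_append ..

theorem part_eq_self {T : Set V} {w : List (V × Bool)} (h : ∀ a ∈ w, a.1 ∈ T) : part T w = w := by
  simpa [part] using h

theorem part_eq_nil {T : Set V} {w : List (V × Bool)} (h : ∀ a ∈ w, a.1 ∉ T) : part T w = [] := by
  simpa [part] using h

theorem part_wordPow (T : Set V) (w : List (V × Bool)) (n : ℕ) :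
    part T (wordPow w n) = wordPow (part T w) n := by
  induction n with
  | zero => rfl
  | succ n ih => rw [wordPow_succ, part_append, ih, wordPow_succ]

theorem traceEq_part {T : Set V} {w : List (V × Bool)}
    (h : ∀ a ∈ w, a.1 ∈ T ∨ ∀ t ∈ T, Γ.Adj a.1 t) :
    TraceEq Γ w (part T w ++ part Tᶜ w) := by
  induction w with
  | nil => exact .refl _
  | cons c w ih =>
    have h1 := (ih fun a ha => h a (by simp [ha])).cons c
    by_cases hc : c.1 ∈ T
    · simpa [part, hc] using h1
    · have h2 := (h c (by simp)).resolve_left hc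
      have h3 : TraceEq Γ (part T w ++ c :: part Tᶜ w) (c :: (part T w ++ part Tᶜ w)) :=
        traceEq_move (fun d hd => (h2 _ (mem_part.1 hd).2).symm) _
      simpa [part, hc] using h1.trans h3.symm

theorem count_part (T : Set V) (w : List (V × Bool)) (a : V × Bool) :
    (part T w).count a = if a.1 ∈ T then w.count a else 0 := by
  split_ifs with h
  · exact List.count_filter (by simpa using h)
  · exact List.count_eq_zero.2 fun h' => h (mem_part.1 h').2

/-- A set of vertices is a block of a cyclically reduced element if it consists of vertices that
occur in the element and commutes with the other vertices that occur. -/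
structure IsBlock (f : PCGroup Γ) (T : Set V) : Prop where
  cycRed : CycRed f
  exists_mem : ∀ t ∈ T, ∃ β, (t, β) ∈ nf f
  closed : ∀ c ∈ nf f, c.1 ∈ T ∨ ∀ t ∈ T, Γ.Adj c.1 t

variable {f : PCGroup Γ} {T : Set V}

/-- The factor of a group element that belongs to a block. -/
noncomputable def factor (T : Set V) (f : PCGroup Γ) : PCGroup Γ := ev Γ (part T (nf f))

theorem IsBlock.factor_mul (hT : IsBlock f T) : f = factor T f * factor Tᶜ f := by
  conv_lhs => rw [← ev_nf f, (traceEq_part hT.closed).ev_eq, ev_append]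
  rfl

theorem factor_mem (T : Set V) (f : PCGroup Γ) : factor T f ∈ para Γ T :=
  ev_mem_para fun _ ha => (mem_part.1 ha).2

theorem factor_mem_of_mem {Y : Set V} (T : Set V) {f : PCGroup Γ} (hf : f ∈ para Γ Y) :
    factor T f ∈ para Γ Y :=
  ev_mem_para fun a ha => mem_para_iff.1 hf a (mem_part.1 ha).1

theorem factor_compl_mem (h : ∀ c ∈ nf f, c.1 ∈ T ∨ ∀ t ∈ T, Γ.Adj c.1 t) :
    factor Tᶜ f ∈ para Γ (perp Γ T) := by
  refine ev_mem_para fun a ha t ht => Or.inr ?_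
  exact (h a (mem_part.1 ha).1).resolve_left (mem_part.1 ha).2 t ht

/-- A letter of `w` not commuting with some `t ∈ T` occurs in proportion to a letter at `t` that
occurs in `f`. So it occurs in `f` too, and the block being closed puts it in `T`. -/
theorem closed_of_traceEq {w : List (V × Bool)} (hT : IsBlock f T)
    (h : TraceEq Γ (w ++ nf f) (nf f ++ w)) : ∀ c ∈ w, c.1 ∈ T ∨ ∀ t ∈ T, Γ.Adj c.1 t := by
  intro c hc
  refine or_iff_not_imp_left.2 fun hcT t ht => ?_
  by_contra hadj
  obtain ⟨β, hβ⟩ := hT.exists_mem t ht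
  have h1 := h.count_mul_count (a := c) (b := (t, β)) hadj
  have h2 : 0 < w.count c * (nf f).count (t, β) :=
    Nat.mul_pos (List.count_pos_iff.2 hc) (List.count_pos_iff.2 hβ)
  rw [h1] at h2
  have h3 : c ∈ nf f := List.count_pos_iff.1 (Nat.pos_of_mul_pos_left h2)
  exact hadj ((hT.closed c h3).resolve_left hcT t ht)

theorem IsBlock.cycRed_factor (hT : IsBlock f T) : CycRed (factor T f) := by
  refine cycRed_of_reduced rfl fun n => ?_
  have h1 : TraceEq Γ (wordPow (nf f) n) _ :=
    traceEq_part fun a ha => hT.closed a (mem_of_mem_wordPow ha)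
  rw [← part_wordPow]
  exact ((hT.cycRed.reduced_wordPow n).congr h1).of_append.1

/-- An element that commutes with `f` commutes with the factor of `f` given by a block. -/
theorem IsBlock.commute_factor (hT : IsBlock f T) {h : PCGroup Γ} (hc : Commute h f) :
    Commute h (factor T f) := by
  obtain ⟨M, hM⟩ := hT.cycRed.exists_traceEq one_ne_zero (by simpa using hc)
  have hcl := closed_of_traceEq hT hM
  set g := h * f ^ M with hg
  have h1 : g = factor T g * factor Tᶜ g := by
    conv_lhs => rw [← ev_nf g, (traceEq_part hcl).ev_eq, ev_append]
    rfl
  have h2 : Commute (factor T g) (factor T f) := by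
    have h3 := (hM.filter (fun c => c.1 ∈ T)).ev_eq
    rw [List.filter_append, List.filter_append, ev_append, ev_append] at h3
    exact h3
  have h3 : Commute g (factor T f) := by
    rw [h1]
    exact h2.mul_left (commute_of_mem_perp (factor_mem T f) (factor_compl_mem hcl)).symm
  have h4 : Commute f (factor T f) := by
    conv_lhs => rw [hT.factor_mul]
    exact (Commute.refl _).mul_left
      (commute_of_mem_perp (factor_mem T f) (factor_compl_mem hT.closed)).symm
  simpa [hg] using h3.mul_left (h4.pow_left M).inv_left

end Blocks

end PCGroup

namespace PCGroup

open scoped Classical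

variable {V : Type*} {Γ : SimpleGraph V}

/-! ### Connected factors and the structure of centralisers -/

section Components

/-- The component of a vertex `s` in the non-commutation graph on the vertices of an element. -/
def component (f : PCGroup Γ) (s : V) : Set V :=
  {t | Relation.ReflTransGen (fun a b => (∃ β, (b, β) ∈ nf f) ∧ a ≠ b ∧ ¬ Γ.Adj a b) s t}

variable {f : PCGroup Γ} {s : V} {T : Set V}

theorem mem_component_self (f : PCGroup Γ) (s : V) : s ∈ component f s :=
  Relation.ReflTransGen.refl

theorem isBlock_component (hf : CycRed f) (hs : ∃ β, (s, β) ∈ nf f) :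
    IsBlock f (component f s) where
  cycRed := hf
  exists_mem t ht := by
    rcases Relation.ReflTransGen.cases_tail ht with h | ⟨c, -, h⟩
    · exact h ▸ hs
    · exact h.1
  closed c hc := by
    refine or_iff_not_imp_left.2 fun hcT t ht => ?_
    by_contra hadj
    refine hcT (Relation.ReflTransGen.tail ht ⟨⟨c.2, hc⟩, ?_, fun h => hadj h.symm⟩)
    rintro rfl
    exact hcT ht

/-- In a component with at least two vertices each vertex has a non-commuting neighbour.
Disjointness rules out cancellation between the factor and elements orthogonal to it. -/
theorem disjoint_component_perp {t : V} (ht : t ∈ component f s) (hts : t ≠ s)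
    (hs : ∃ β, (s, β) ∈ nf f) : Disjoint (component f s) (perp Γ (component f s)) := by
  rw [Set.disjoint_left]
  intro r hr hr'
  rcases eq_or_ne r s with rfl | hne
  · rcases Relation.ReflTransGen.cases_head ht with h | ⟨c, hc, -⟩
    · exact hts h.symm
    · have h1 := hr' c (Relation.ReflTransGen.single hc)
      exact h1.elim hc.2.1 hc.2.2
  · rcases Relation.ReflTransGen.cases_tail hr with h | ⟨c, hc, hcr⟩
    · exact hne h
    · have h1 := hr' c hc
      exact h1.elim (fun h => hcr.2.1 h.symm) fun h => hcr.2.2 h.symm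

/-- An element that commutes with a cyclically reduced element `f` is the product of an element
commensurable with a connected factor of `f` and an element orthogonal to that factor. -/
theorem exists_mul_of_commute {Y : Set V} {h : PCGroup Γ} (hf : CycRed f)
    (hs : ∃ β, (s, β) ∈ nf f) (hfY : f ∈ para Γ Y) (hhY : h ∈ para Γ Y) (hc : Commute h f) :
    ∃ a b : PCGroup Γ, h = a * b ∧ a ∈ para Γ (component f s) ∧ a ∈ para Γ Y ∧
      b ∈ para Γ (Y ∩ perp Γ (component f s)) ∧
      ∃ p : ℕ, p ≠ 0 ∧ ∃ n : ℤ, a ^ p = factor (component f s) f ^ n := by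
  have hT := isBlock_component hf hs
  obtain ⟨M, hM⟩ := hf.exists_traceEq one_ne_zero (by simpa using hc)
  have hcl := closed_of_traceEq hT hM
  obtain ⟨β, hβ⟩ := hs
  set T := component f s with hTdef
  set g := h * f ^ M with hg
  have hgY : g ∈ para Γ Y := mul_mem hhY (pow_mem hfY M)
  -- The ratio of the counts in `g` and `f` is carried from `s` along the paths of the component;
  -- each step cancels the positive count of a letter occurring in `f`.
  have hprop : ∀ t ∈ T, ∀ a : V × Bool, a.1 = t →
      (nf f).count (s, β) * (nf g).count a = (nf g).count (s, β) * (nf f).count a := by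
    intro t ht
    induction ht with
    | refl =>
      intro a ha
      have := hM.count_mul_count (a := a) (b := (s, β)) (by rw [ha]; exact Γ.irrefl)
      rw [mul_comm, this]
    | tail ht hbt ih =>
      rename_i b t
      intro a ha
      obtain ⟨γ, hγ⟩ := hT.exists_mem b ht
      have h1 := ih (b, γ) rfl
      have h2 := hM.count_mul_count (a := a) (b := (b, γ))
        (by rw [ha]; exact fun h => hbt.2.2 h.symm)
      refine Nat.eq_of_mul_eq_mul_right (List.count_pos_iff.2 hγ) ?_
      rw [mul_assoc, h2, ← mul_assoc, h1]
      ring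
  have h1 : TraceEq Γ (part T (nf g) ++ part T (nf f)) (part T (nf f) ++ part T (nf g)) := by
    have := hM.filter (fun c => c.1 ∈ T)
    rwa [List.filter_append, List.filter_append] at this
  have hpow : factor T g ^ (nf f).count (s, β) = factor T f ^ (nf g).count (s, β) := by
    have h2 := (h1.wordPow_eq (p := (nf f).count (s, β)) (n := (nf g).count (s, β)) fun a => by
      rw [count_part, count_part]
      split_ifs with ha
      · exact hprop a.1 ha a rfl
      · simp).ev_eq
    rwa [ev_wordPow, ev_wordPow] at h2
  have hcomm : Commute (factor T g) (factor T f) := by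
    have h2 := h1.ev_eq
    rwa [ev_append, ev_append] at h2
  have hgN := factor_compl_mem hcl
  have hfN := factor_compl_mem hT.closed
  have hgm : g = factor T g * factor Tᶜ g := by
    conv_lhs => rw [← ev_nf g, (traceEq_part hcl).ev_eq, ev_append]
    rfl
  have hfm : f ^ M = factor T f ^ M * factor Tᶜ f ^ M := by
    conv_lhs => rw [hT.factor_mul]
    exact (commute_of_mem_perp (factor_mem T f) hfN).mul_pow M
  refine ⟨factor T g * (factor T f ^ M)⁻¹, factor Tᶜ g * (factor Tᶜ f ^ M)⁻¹, ?_, ?_, ?_, ?_,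
    (nf f).count (s, β), (List.count_pos_iff.2 hβ).ne', (nf g).count (s, β) -
      (M * (nf f).count (s, β) : ℤ), ?_⟩
  · have h1 : h = g * (f ^ M)⁻¹ := by rw [hg, mul_inv_cancel_right]
    have h2 : Commute (factor T f ^ M)⁻¹ (factor Tᶜ g * (factor Tᶜ f ^ M)⁻¹) :=
      commute_of_mem_perp (inv_mem (pow_mem (factor_mem T f) M))
        (mul_mem hgN (inv_mem (pow_mem hfN M)))
    rw [h1, hfm, mul_assoc (factor T g), h2.eq]
    conv_lhs => rw [hgm]
    group
  · exact mul_mem (factor_mem T g) (inv_mem (pow_mem (factor_mem T f) M))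
  · exact mul_mem (factor_mem_of_mem T hgY) (inv_mem (pow_mem (factor_mem_of_mem T hfY) M))
  · rw [← para_inf]
    exact Subgroup.mem_inf.2
      ⟨mul_mem (factor_mem_of_mem _ hgY) (inv_mem (pow_mem (factor_mem_of_mem _ hfY) M)),
        mul_mem hgN (inv_mem (pow_mem hfN M))⟩
  · rw [(hcomm.pow_right M).inv_right.mul_pow, hpow, zpow_sub, zpow_natCast, inv_pow, ← pow_mul]
    congr 2

theorem reduced_append_of_disjoint {a b : PCGroup Γ} {B : Set V} (h : Disjoint T B)
    (ha : a ∈ para Γ T) (hb : b ∈ para Γ B) : Reduced Γ (nf a ++ nf b) := by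
  by_contra hcon
  obtain ⟨c, u₁, m₁, m₂, w₂, h1, h2, -⟩ :=
    exists_cancelling_append (nf_reduced a) (nf_reduced b) hcon
  exact Set.disjoint_left.1 h (mem_para_iff.1 ha c (by simp [h1]))
    (mem_para_iff.1 hb (opp c) (by simp [h2]))

theorem len_mul_of_disjoint {a b : PCGroup Γ} {B : Set V} (h : Disjoint T B)
    (ha : a ∈ para Γ T) (hb : b ∈ para Γ B) : len (a * b) = len a + len b := by
  have := (reduced_append_of_disjoint h ha hb).len_eq
  simpa [len] using this

/-- Conjugation inside `⟨T^⊥⟩` fixes the factor and makes `l` cyclically reduced. Then `T` is a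
block of the product with factor `x ^ n`, to which `commute_factor` applies, and roots can be taken.
-/
theorem IsBlock.commute_of_commute_pow_mul (hT : IsBlock f T) (hd : Disjoint T (perp Γ T))
    {n : ℕ} (hn : n ≠ 0) {l g : PCGroup Γ} (hl : l ∈ para Γ (perp Γ T))
    (hc : Commute g (factor T f ^ n * l)) : Commute g (factor T f) := by
  obtain ⟨z, hz, hzl⟩ := exists_conj_cycRed hl
  set x := factor T f with hx
  set l' := z * l * z⁻¹ with hl'
  have hl'm : l' ∈ para Γ (perp Γ T) := mul_mem (mul_mem hz hl) (inv_mem hz)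
  have hxT : ∀ m : ℕ, x ^ m ∈ para Γ T := fun m => pow_mem (factor_mem T f) m
  have hzx : ∀ m : ℕ, z * x ^ m * z⁻¹ = x ^ m := fun m => by
    rw [← (commute_of_mem_perp (hxT m) hz).eq, mul_inv_cancel_right]
  have hxl : Commute (x ^ n) l' := commute_of_mem_perp (hxT n) hl'm
  have hcyc : CycRed (x ^ n * l') := by
    intro m
    rw [hxl.mul_pow, len_mul_of_disjoint hd (pow_mem (hxT n) m) (pow_mem hl'm m),
      len_mul_of_disjoint hd (hxT n) hl'm, hzl m, ← pow_mul, hT.cycRed_factor, hT.cycRed_factor]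
    ring
  have htr : TraceEq Γ (nf (x ^ n * l')) (nf (x ^ n) ++ nf l') := by
    have := nf_traceEq (reduced_append_of_disjoint hd (hxT n) hl'm)
    simpa using this
  have htrx : TraceEq Γ (nf (x ^ n)) (wordPow (part T (nf f)) n) := by
    refine (nf_reduced _).traceEq ?_ (by simp [hx, factor])
    rw [← part_wordPow]
    have h1 : TraceEq Γ (wordPow (nf f) n) _ :=
      traceEq_part fun a ha => hT.closed a (mem_of_mem_wordPow ha)
    exact ((hT.cycRed.reduced_wordPow n).congr h1).of_append.1
  have hblock : IsBlock (x ^ n * l') T := by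
    refine ⟨hcyc, fun t ht => ?_, fun c hcm => ?_⟩
    · obtain ⟨β, hβ⟩ := hT.exists_mem t ht
      refine ⟨β, htr.perm.mem_iff.2 (List.mem_append_left _ (htrx.perm.mem_iff.2 ?_))⟩
      obtain ⟨k, rfl⟩ := Nat.exists_eq_succ_of_ne_zero hn
      rw [wordPow_succ]
      exact List.mem_append_left _ (mem_part.2 ⟨hβ, ht⟩)
    · rcases List.mem_append.1 (htr.perm.subset hcm) with h | h
      · exact Or.inl (mem_para_iff.1 (hxT n) c h)
      · have h1 := mem_para_iff.1 hl'm c h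
        refine Or.inr fun t ht => (h1 t ht).resolve_left ?_
        rintro rfl
        exact Set.disjoint_left.1 hd ht h1
  have hfac : factor T (x ^ n * l') = x ^ n := by
    have h1 := (htr.filter fun c => c.1 ∈ T).ev_eq
    rw [List.filter_append] at h1
    have h2 : List.filter (fun c => decide (c.1 ∈ T)) (nf l') = [] :=
      part_eq_nil fun a ha hat => Set.disjoint_left.1 hd hat (mem_para_iff.1 hl'm a ha)
    have h3 : List.filter (fun c => decide (c.1 ∈ T)) (nf (x ^ n)) = nf (x ^ n) :=
      part_eq_self (mem_para_iff.1 (hxT n))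
    rw [h2, h3, List.append_nil, ev_nf] at h1
    exact h1
  have hconj : x ^ n * l' = z * (x ^ n * l) * z⁻¹ := by
    calc _ = z * x ^ n * z⁻¹ * l' := by rw [hzx]
      _ = _ := by rw [hl']; group
  have h1 : Commute (z * g * z⁻¹) (x ^ n * l') := by rwa [hconj, commute_conj_iff]
  have h2 := hblock.commute_factor h1
  rw [hfac, ← hzx n, commute_conj_iff] at h2
  exact commute_of_commute_pow hn h2

/-- An element that commutes with `a * b`, where `a` is commensurable with a connected factor of
`f` and `b` is orthogonal to this factor, commutes with the factor. -/
theorem IsBlock.commute_of_commute_mul (hT : IsBlock f T) (hd : Disjoint T (perp Γ T))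
    {a b g : PCGroup Γ} (ha : a ∈ para Γ T) (hb : b ∈ para Γ (perp Γ T)) {p : ℕ} {n : ℤ}
    (hn : n ≠ 0) (hab : a ^ p = factor T f ^ n) (hc : Commute g (a * b)) :
    Commute g (factor T f) := by
  have h1 : Commute g (factor T f ^ n * b ^ p) := by
    rw [← hab, ← (commute_of_mem_perp ha hb).mul_pow]
    exact hc.pow_right p
  have hn' : n.natAbs ≠ 0 := by simpa using hn
  rcases Int.natAbs_eq n with h | h
  · rw [h, zpow_natCast] at h1
    exact hT.commute_of_commute_pow_mul hd hn' (pow_mem hb p) h1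
  · refine hT.commute_of_commute_pow_mul hd hn' (inv_mem (pow_mem hb p)) (l := (b ^ p)⁻¹) ?_
    rw [h, zpow_neg, zpow_natCast] at h1
    have h2 := h1.inv_right
    rwa [mul_inv_rev, inv_inv, ← (commute_of_mem_perp (pow_mem (factor_mem T f) _)
      (inv_mem (pow_mem hb p))).eq] at h2

end Components

end PCGroup

/-! ### From chains of centralisers to sequences of vertices -/

namespace PCGroup

variable {V : Type*} {Γ : SimpleGraph V}

/-- There is a sequence of `k` vertices for which the set of vertices in `Y` that commute with the
initial segments of the sequence decreases strictly. -/
inductive Desc (Γ : SimpleGraph V) : Set V → ℕ → Prop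
  | zero (Y : Set V) : Desc Γ Y 0
  | succ {Y : Set V} {k : ℕ} (x r : V) (hr : r ∈ Y) (hrx : r ∉ perp Γ {x})
      (h : Desc Γ (Y ∩ perp Γ {x}) k) : Desc Γ Y (k + 1)

theorem Desc.mono {Y : Set V} {k : ℕ} (h : Desc Γ Y k) : ∀ {Z : Set V}, Y ⊆ Z → Desc Γ Z k := by
  induction h with
  | zero Y => exact fun _ => .zero _
  | succ x r hr hrx _ ih =>
    exact fun hYZ => .succ x r (hYZ hr) hrx (ih (Set.inter_subset_inter_left _ hYZ))

theorem perp_anti {B C : Set V} (h : B ⊆ C) : perp Γ C ⊆ perp Γ B :=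
  fun _ hv b hb => hv b (h hb)

/-- A single vertex of `B` not commuting with `r` gives the new step; the set it leaves contains `Y
∩ B^⊥`. -/
theorem Desc.of_inter_perp {Y B : Set V} {k : ℕ} {r : V} (hr : r ∈ Y) (hrB : r ∉ perp Γ B)
    (h : Desc Γ (Y ∩ perp Γ B) k) : Desc Γ Y (k + 1) := by
  simp only [perp, Set.mem_ofPred_eq, not_forall] at hrB
  obtain ⟨x, hx, hrx⟩ := hrB
  refine .succ x r hr (by simpa [perp] using hrx) (h.mono ?_)
  exact Set.inter_subset_inter_right _ (perp_anti (by simpa using hx))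

/-- A strictly descending chain of length `k` of centralisers relative to the subgroup generated by
a set of vertices. -/
structure RelChain (Γ : SimpleGraph V) (Y : Set V) (k : ℕ) (D : ℕ → Subgroup (PCGroup Γ)) :
    Prop where
  exists_eq : ∀ i ≤ k, ∃ S : Set (PCGroup Γ), D i = para Γ Y ⊓ Subgroup.centralizer S
  lt : ∀ i < k, D (i + 1) < D i

variable {Y : Set V} {k : ℕ} {D : ℕ → Subgroup (PCGroup Γ)}

theorem RelChain.le_zero (h : RelChain Γ Y k D) {i : ℕ} (hi : i ≤ k) : D i ≤ D 0 := by
  induction i with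
  | zero => exact le_rfl
  | succ i ih => exact (h.lt i hi).le.trans (ih (by omega))

theorem RelChain.conj (h : RelChain Γ Y k D) {z : PCGroup Γ} (hz : z ∈ para Γ Y) :
    RelChain Γ Y k fun i => (D i).map (MulAut.conj z).toMonoidHom := by
  refine ⟨fun i hi => ?_, fun i hi => ?_⟩
  · obtain ⟨S, hS⟩ := h.exists_eq i hi
    refine ⟨(fun g => z * g * z⁻¹) '' S, ?_⟩
    ext g
    rw [Subgroup.mem_map_equiv, hS, Subgroup.mem_inf, Subgroup.mem_inf, Subgroup.mem_centralizer_iff,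
      Subgroup.mem_centralizer_iff, MulAut.conj_symm_apply]
    refine and_congr ⟨fun h1 => ?_, fun h1 => mul_mem (mul_mem (inv_mem hz) h1) hz⟩ ?_
    · have := mul_mem (mul_mem hz h1) (inv_mem hz)
      rwa [← mul_assoc, ← mul_assoc, mul_inv_cancel, one_mul, mul_inv_cancel_right] at this
    · rw [Set.forall_mem_image]
      refine forall₂_congr fun s _ => ?_
      have h1 := commute_conj_iff z s (z⁻¹ * g * z)
      have h2 : z * (z⁻¹ * g * z) * z⁻¹ = g := by group
      rw [h2] at h1
      exact h1.symm
  · exact (Subgroup.map_lt_map_iff_of_injective (MulAut.conj z).injective).2 (h.lt i hi)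

theorem RelChain.restrict (h : RelChain Γ Y k D) {Z : Set V} (hZY : Z ⊆ Y)
    (hD : D 0 ≤ para Γ Z) : RelChain Γ Z k D := by
  refine ⟨fun i hi => ?_, h.lt⟩
  obtain ⟨S, hS⟩ := h.exists_eq i hi
  refine ⟨S, le_antisymm (le_inf ((h.le_zero hi).trans hD) (hS ▸ inf_le_right)) ?_⟩
  rw [hS]
  exact inf_le_inf_right _ (para_le_para_iff.2 hZY)

theorem RelChain.desc_of_le (h : RelChain Γ Y k D)
    (ih : ∀ Z, Z ⊂ Y → ∀ k D, RelChain Γ Z k D → Desc Γ Z k) {B : Set V}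
    (hD : D 0 ≤ para Γ (Y ∩ perp Γ B)) {r : V} (hr : r ∈ Y) (hrB : r ∉ perp Γ B) :
    Desc Γ Y (k + 1) :=
  .of_inter_perp hr hrB <|
    ih _ ⟨Set.inter_subset_left, fun h => hrB (h hr).2⟩ k D (h.restrict Set.inter_subset_left hD)

/-- Whether an element `a * b` of `C(f)` belongs to a term is decided by `x` and `b` when `a ≠ 1`,
and by `b` alone otherwise. So only the step at which `x` drops out can collapse in `⟨Y ∩ T^⊥⟩`. -/
theorem RelChain.inter_perp {f : PCGroup Γ} {s t : V} (hf : CycRed f)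
    (hs : ∃ β, (s, β) ∈ nf f) (ht : t ∈ component f s) (hts : t ≠ s) (hfY : f ∈ para Γ Y)
    (h : RelChain Γ Y (k + 1) D) (hD : D 0 ≤ Subgroup.centralizer {f}) :
    ∃ E, RelChain Γ (Y ∩ perp Γ (component f s)) k E := by
  classical
  have hT := isBlock_component hf hs
  have hd := disjoint_component_perp ht hts hs
  set T := component f s with hTdef
  set x := factor T f with hx
  have hxY : x ∈ para Γ Y := factor_mem_of_mem T hfY
  have hx_anti : ∀ i ≤ k, x ∈ D (i + 1) → x ∈ D i := fun i hi h1 => (h.lt i (by omega)).le h1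
  have hle : ∀ i ≤ k, D (i + 1) ⊓ para Γ (Y ∩ perp Γ T) ≤ D i ⊓ para Γ (Y ∩ perp Γ T) :=
    fun i hi => inf_le_inf_right _ (h.lt i (by omega)).le
  have hlt : ∀ i ≤ k, (x ∈ D i ↔ x ∈ D (i + 1)) →
      D (i + 1) ⊓ para Γ (Y ∩ perp Γ T) < D i ⊓ para Γ (Y ∩ perp Γ T) := by
    intro i hi hxi
    refine lt_of_le_of_ne (hle i hi) fun heq => (h.lt i (by omega)).not_ge fun g hg => ?_
    obtain ⟨S, hS⟩ := h.exists_eq i (by omega)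
    obtain ⟨S', hS'⟩ := h.exists_eq (i + 1) (by omega)
    have hgY : g ∈ para Γ Y := (hS ▸ hg : g ∈ para Γ Y ⊓ Subgroup.centralizer S).1
    have hgS : ∀ u ∈ S, Commute u g :=
      Subgroup.mem_centralizer_iff.1 (hS ▸ hg : g ∈ para Γ Y ⊓ Subgroup.centralizer S).2
    have hgf : Commute g f := by
      exact Subgroup.mem_centralizer_singleton_iff.1 (hD (h.le_zero (by omega) hg))
    obtain ⟨a, b, rfl, haT, haY, hb, p, hp, n, hpn⟩ := exists_mul_of_commute hf hs hfY hgY hgf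
    have hbT : b ∈ para Γ (perp Γ T) := para_le_para_iff.2 Set.inter_subset_right hb
    have hbY : b ∈ para Γ Y := para_le_para_iff.2 Set.inter_subset_left hb
    have hmem : b ∈ D i → b ∈ D (i + 1) := fun hbi => by
      have : b ∈ D (i + 1) ⊓ para Γ (Y ∩ perp Γ T) := heq ▸ Subgroup.mem_inf.2 ⟨hbi, hb⟩
      exact this.1
    by_cases hn : n = 0
    · rw [hn, zpow_zero] at hpn
      rw [eq_one_of_pow_eq_one hp hpn, one_mul] at hg ⊢
      exact hmem hg
    · have hxi' : x ∈ D i := by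
        rw [hS]
        refine Subgroup.mem_inf.2 ⟨hxY, Subgroup.mem_centralizer_iff.2 fun u hu => ?_⟩
        exact hT.commute_of_commute_mul hd haT hbT hn hpn (hgS u hu)
      have key : ∀ j S, D j = para Γ Y ⊓ Subgroup.centralizer S → x ∈ D j → a ∈ D j := by
        intro j S hS hxj
        rw [hS] at hxj ⊢
        refine Subgroup.mem_inf.2 ⟨haY, Subgroup.mem_centralizer_iff.2 fun u hu => ?_⟩
        have h1 : Commute u x := Subgroup.mem_centralizer_iff.1 hxj.2 u hu
        exact commute_of_commute_pow hp (hpn ▸ h1.zpow_right n)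
      have hai : a ∈ D i := key i S hS hxi'
      exact mul_mem (key (i + 1) S' hS' (hxi.1 hxi'))
        (hmem (by simpa using mul_mem (inv_mem hai) hg))
  -- The shift after `x` has left skips the one step that may collapse.
  refine ⟨fun i => D (if x ∈ D i then i else i + 1) ⊓ para Γ (Y ∩ perp Γ T),
    fun i hi => ?_, fun i hi => ?_⟩
  · obtain ⟨S, hS⟩ := h.exists_eq (if x ∈ D i then i else i + 1) (by split_ifs <;> omega)
    refine ⟨S, ?_⟩
    simp only [hS]
    rw [inf_right_comm, inf_eq_right.2 (para_le_para_iff.2 Set.inter_subset_left)]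
  · by_cases h1 : x ∈ D i
    · by_cases h2 : x ∈ D (i + 1)
      · simpa [h1, h2] using hlt i hi.le (by simp [h1, h2])
      · have h3 : x ∉ D (i + 2) := fun h3 => h2 (hx_anti (i + 1) hi h3)
        simpa [h1, h2] using (hlt (i + 1) hi (by simp [h2, h3])).trans_le (hle i hi.le)
    · have h2 : x ∉ D (i + 1) := fun h2 => h1 (hx_anti i hi.le h2)
      have h3 : x ∉ D (i + 2) := fun h3 => h2 (hx_anti (i + 1) hi h3)
      simpa [h1, h2] using hlt (i + 1) hi (by simp [h2, h3])

theorem RelChain.desc_of_cycRed (h : RelChain Γ Y k D)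
    (ih : ∀ Z, Z ⊂ Y → ∀ k D, RelChain Γ Z k D → Desc Γ Z k) {f g : PCGroup Γ} (hf : CycRed f)
    (hfY : f ∈ para Γ Y) (hg : g ∈ para Γ Y) (hgf : ¬ Commute g f)
    (hD : D 0 ≤ Subgroup.centralizer {f}) : Desc Γ Y (k + 1) := by
  obtain ⟨s, hs, r, hr, hrs⟩ : ∃ s, (∃ β, (s, β) ∈ nf f) ∧ ∃ r ∈ Y, r ∉ perp Γ {s} := by
    by_contra! hcon
    refine hgf (commute_of_mem_perp hg (mem_para_iff.2 fun a ha r hr => ?_))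
    rcases hcon a.1 ⟨a.2, ha⟩ r hr a.1 rfl with h1 | h1
    exacts [Or.inl h1.symm, Or.inr h1.symm]
  by_cases hts : ∃ t ∈ component f s, t ≠ s
  · obtain ⟨t, ht, hts⟩ := hts
    have hsT := mem_component_self f s
    have hsY : s ∈ Y := by
      obtain ⟨β, hβ⟩ := hs
      exact mem_para_iff.1 hfY _ hβ
    have hs_perp := Set.disjoint_left.1 (disjoint_component_perp ht hts hs) hsT
    refine .of_inter_perp hr hrs ?_
    cases k with
    | zero => exact .zero _
    | succ k =>
      obtain ⟨E, hE⟩ := h.inter_perp hf hs ht hts hfY hD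
      -- The second of two gained steps: the vertex `s` has removed `r`, and now a vertex of `T`
      -- removes `s`. Together they replace the step lost in `T^⊥` and supply the extra one.
      refine .of_inter_perp (r := s) ⟨hsY, by simp [perp]⟩ hs_perp ?_
      refine (ih _ ⟨Set.inter_subset_left, fun h1 => hs_perp (h1 hsY).2⟩ k E hE).mono ?_
      exact fun v hv => ⟨⟨hv.1, perp_anti (by simpa using hsT) hv.2⟩, hv.2⟩
  · push Not at hts
    refine h.desc_of_le ih (B := {s}) (fun u hu => ?_) hr hrs
    obtain ⟨S, hS⟩ := h.exists_eq 0 (by omega)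
    have huY : u ∈ para Γ Y := (hS ▸ hu : u ∈ para Γ Y ⊓ Subgroup.centralizer S).1
    obtain ⟨a, b, rfl, haT, haY, hb, -⟩ := exists_mul_of_commute hf hs hfY huY
      (Subgroup.mem_centralizer_singleton_iff.1 (hD hu))
    refine mul_mem ?_ (para_le_para_iff.2
      (Set.inter_subset_inter_right _ (perp_anti (by simpa using mem_component_self f s))) hb)
    rw [← para_inf]
    refine Subgroup.mem_inf.2 ⟨haY, para_le_para_iff.2 (fun v hv => ?_) haT⟩
    rw [hts v hv]
    simp [perp]

theorem RelChain.desc_of_not_commute (h : RelChain Γ Y k D)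
    (ih : ∀ Z, Z ⊂ Y → ∀ k D, RelChain Γ Z k D → Desc Γ Z k) {g u : PCGroup Γ}
    (hu : u ∈ para Γ Y) (hug : ¬ Commute u g) (hD : D 0 ≤ Subgroup.centralizer {g}) :
    Desc Γ Y (k + 1) := by
  classical
  have hex : ∃ n, ∃ p ∈ para Γ Y, ∃ r ∈ para Γ Y, len (p * g * r) = n :=
    ⟨_, 1, one_mem _, 1, one_mem _, rfl⟩
  obtain ⟨p, hp, r, hr, hn⟩ := Nat.find_spec hex
  set q := p * g * r with hq
  have hmin : ∀ p' ∈ para Γ Y, ∀ r' ∈ para Γ Y, len q ≤ len (p' * q * r') := by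
    intro p' hp' r' hr'
    rw [hn]
    exact Nat.find_min' hex ⟨p' * p, mul_mem hp' hp, r * r', mul_mem hr hr', by
      rw [hq]; simp only [mul_assoc]⟩
  have hD0 : D 0 ≤ para Γ Y := by
    obtain ⟨S, hS⟩ := h.exists_eq 0 (by omega)
    exact hS ▸ inf_le_left
  have key : ∀ v ∈ D 0, p * v * p⁻¹ = r⁻¹ * v * r ∧
      ∀ a ∈ nf (p * v * p⁻¹), ∀ b ∈ nf q, Γ.Adj a.1 b.1 := by
    intro v hv
    have hc : v * g = g * v := Subgroup.mem_centralizer_singleton_iff.1 (hD hv)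
    refine eq_of_mul_eq_mul hmin (mul_mem (mul_mem hp (hD0 hv)) (inv_mem hp))
      (mul_mem (mul_mem (inv_mem hr) (hD0 hv)) hr) ?_
    calc p * v * p⁻¹ * q = p * (v * g) * r := by rw [hq]; group
      _ = q * (r⁻¹ * v * r) := by rw [hc, hq]; group
  set B : Set V := {x | ∃ b ∈ nf q, b.1 = x} with hB
  by_cases hYB : Y ⊆ perp Γ B
  · have hqB : q ∈ para Γ B := mem_para_iff.2 fun b hb => ⟨b, hb, rfl⟩
    have hqY : ∀ v ∈ para Γ Y, Commute q v := fun v hv =>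
      commute_of_mem_perp hqB (para_le_para_iff.2 hYB hv)
    -- Here `g = q * (p⁻¹ * r⁻¹)` with `q` centralising `⟨Y⟩`, so `p⁻¹ * r⁻¹` takes over the role of
    -- `g`. Its conjugate by `p` is `r⁻¹ * p⁻¹`, which is then made cyclically reduced.
    obtain ⟨z, hz, hzf⟩ :=
      exists_conj_cycRed (mul_mem (inv_mem hr) (inv_mem hp) : r⁻¹ * p⁻¹ ∈ para Γ Y)
    have hzp := mul_mem hz hp
    refine (h.conj hzp).desc_of_cycRed ih hzf
      (mul_mem (mul_mem hz (mul_mem (inv_mem hr) (inv_mem hp))) (inv_mem hz))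
      (mul_mem (mul_mem hzp hu) (inv_mem hzp)) (fun hcom => hug ?_) ?_
    · have h1 : z * p * u * (z * p)⁻¹ = z * (p * u * p⁻¹) * z⁻¹ := by group
      have h2 : r⁻¹ * p⁻¹ = p * (p⁻¹ * r⁻¹) * p⁻¹ := by group
      rw [h1, commute_conj_iff, h2, commute_conj_iff] at hcom
      have h3 : g = q * (p⁻¹ * r⁻¹) := by
        calc g = p⁻¹ * q * r⁻¹ := by rw [hq]; group
          _ = _ := by rw [← (hqY _ (inv_mem hp)).eq, mul_assoc]
      rw [h3]
      exact (hqY u hu).symm.mul_right hcom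
    · rintro _ ⟨v, hv, rfl⟩
      rw [Subgroup.mem_centralizer_singleton_iff]
      have h1 : Commute (z * (p * v * p⁻¹) * z⁻¹) (z * (r⁻¹ * p⁻¹) * z⁻¹) := by
        rw [commute_conj_iff]
        calc p * v * p⁻¹ * (r⁻¹ * p⁻¹) = r⁻¹ * v * r * (r⁻¹ * p⁻¹) := by rw [(key v hv).1]
          _ = r⁻¹ * p⁻¹ * (p * v * p⁻¹) := by group
      have h2 : z * (p * v * p⁻¹) * z⁻¹ = z * p * v * (z * p)⁻¹ := by group
      rw [h2] at h1
      exact h1.eq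
  · obtain ⟨y, hy, hyB⟩ := Set.not_subset.1 hYB
    refine (h.conj hp).desc_of_le ih (B := B) ?_ hy hyB
    rintro _ ⟨v, hv, rfl⟩
    refine mem_para_iff.2 fun a ha => ⟨?_, ?_⟩
    · exact mem_para_iff.1 (mul_mem (mul_mem hp (hD0 hv)) (inv_mem hp)) a ha
    · rintro _ ⟨b, hb, rfl⟩
      exact Or.inr ((key v hv).2 a ha b hb)

/-- The length of a chain of centralisers relative to the subgroup generated by a set of vertices is
attained by a chain of centralisers of vertices. -/
theorem RelChain.desc [Finite V] (h : RelChain Γ Y k D) : Desc Γ Y k := by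
  induction hn : Y.ncard using Nat.strong_induction_on generalizing Y k D with
  | _ n ih =>
    cases k with
    | zero => exact .zero _
    | succ k =>
      obtain ⟨u, hu, hu'⟩ := SetLike.exists_of_lt (h.lt 0 (by omega))
      obtain ⟨S, hS⟩ := h.exists_eq 0 (by omega)
      obtain ⟨S', hS'⟩ := h.exists_eq 1 (by omega)
      have huY : u ∈ para Γ Y := (hS ▸ hu : u ∈ para Γ Y ⊓ Subgroup.centralizer S).1
      have hu'' : ¬ ∀ g ∈ S', g * u = u * g := fun hcon => hu' (by
        rw [zero_add, hS']
        exact Subgroup.mem_inf.2 ⟨huY, Subgroup.mem_centralizer_iff.2 hcon⟩)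
      push Not at hu''
      obtain ⟨g, hg, hgu⟩ := hu''
      -- The top term is dropped, so that all remaining terms centralise `g`; the pair `u, g` gives
      -- the missing step back.
      have hchain : RelChain Γ Y k fun i => D (i + 1) :=
        ⟨fun i hi => h.exists_eq (i + 1) (by omega), fun i hi => h.lt (i + 1) (by omega)⟩
      refine hchain.desc_of_not_commute (g := g) (u := u) (fun Z hZ k D hD => ?_) huY
        (fun hc => hgu hc.eq.symm) ?_
      · exact ih _ (hn ▸ Set.ncard_lt_ncard hZ) hD rfl
      · rw [zero_add, hS']
        exact inf_le_right.trans (Subgroup.centralizer_le (by simpa using hg))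

end PCGroup

/-! ### Canonical centralisers and the theorem -/

namespace PCGroup

variable {V : Type*} {Γ : SimpleGraph V}

theorem traceEq_nf_gen (y : V) : TraceEq Γ (nf (gen Γ y)) [(y, true)] := by
  simpa [letter] using nf_traceEq (reduced_singleton (Γ := Γ) (y, true))

theorem cycRed_gen (y : V) : CycRed (gen Γ y) := by
  refine cycRed_of_reduced (w := [(y, true)]) (by simp [letter]) fun n => ?_
  by_contra hcon
  obtain ⟨p, a, m, s, h, -⟩ := exists_cancelling hcon
  have h1 : a = (y, true) :=
    List.mem_singleton.1 (mem_of_mem_wordPow (n := n) (by rw [h]; simp))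
  have h2 : opp a = (y, true) :=
    List.mem_singleton.1 (mem_of_mem_wordPow (n := n) (by rw [h]; simp))
  exact opp_ne a (h2.trans h1.symm)

theorem mem_para_perp_of_commute {y : V} {g : PCGroup Γ} (h : Commute g (gen Γ y)) :
    g ∈ para Γ (perp Γ {y}) := by
  have hmem : ∀ {t β}, (t, β) ∈ nf (gen Γ y) → t = y := fun h => by
    simpa using congrArg Prod.fst (List.mem_singleton.1 ((traceEq_nf_gen y).perm.subset h))
  have hy : ∃ β, (y, β) ∈ nf (gen Γ y) :=
    ⟨true, (traceEq_nf_gen y).perm.mem_iff.2 (by simp)⟩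
  obtain ⟨a, b, rfl, ha, -, hb, -⟩ := exists_mul_of_commute (Y := Set.univ) (cycRed_gen y) hy
    (by simp) (by simp) h
  refine mul_mem (para_le_para_iff.2 (fun t ht => ?_) ha) (para_le_para_iff.2 ?_ hb)
  · obtain ⟨β, hβ⟩ := (isBlock_component (cycRed_gen y) hy).exists_mem t ht
    simp [perp, hmem hβ]
  · exact Set.inter_subset_right.trans (perp_anti (by simpa using mem_component_self _ y))

/-- The centraliser of a set of vertices is generated by the vertices that commute with them. -/
theorem centralizer_gen_image (Y : Set V) :
    Subgroup.centralizer (gen Γ '' Y) = para Γ (perp Γ Y) := by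
  refine le_antisymm (fun g hg => mem_para_iff.2 fun a ha y hy => ?_) fun g hg => ?_
  · have h1 : Commute g (gen Γ y) :=
      (Subgroup.mem_centralizer_iff.1 hg _ ⟨y, hy, rfl⟩).symm
    exact mem_para_iff.1 (mem_para_perp_of_commute h1) a ha y rfl
  · rw [Subgroup.mem_centralizer_iff]
    rintro _ ⟨y, hy, rfl⟩
    exact (commute_of_mem_perp (gen_mem_para_iff.2 hy) hg).eq

theorem centralizer_para (Y : Set V) :
    Subgroup.centralizer (para Γ Y : Set (PCGroup Γ)) = Subgroup.centralizer (gen Γ '' Y) := by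
  exact Subgroup.centralizer_closure _

/-- With `U = Y^⊥ ∪ Z^⊥`, the join is the double centraliser `C(U^⊥)`: if `C(S)` contains both, then
`S` centralises `U`, so `S ⊆ ⟨U^⊥⟩`. -/
theorem isSublattice_canonicalCentralisers (Γ : SimpleGraph V) :
    IsSublattice (canonicalCentralisers Γ) := by
  constructor
  · rintro _ ⟨Y, rfl⟩ _ ⟨Z, rfl⟩
    set U := perp Γ Y ∪ perp Γ Z with hU
    refine ⟨perp Γ U, le_antisymm (sup_le ?_ ?_) ?_⟩
    · change Subgroup.centralizer _ ≤ Subgroup.centralizer _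
      rw [centralizer_gen_image, centralizer_gen_image, para_le_para_iff]
      intro v hv u hu
      exact (hu v (Or.inl hv)).imp Eq.symm SimpleGraph.Adj.symm
    · change Subgroup.centralizer _ ≤ Subgroup.centralizer _
      rw [centralizer_gen_image, centralizer_gen_image, para_le_para_iff]
      intro v hv u hu
      exact (hu v (Or.inr hv)).imp Eq.symm SimpleGraph.Adj.symm
    · change Subgroup.centralizer (gen Γ '' perp Γ U) ≤ sInf _
      refine le_sInf ?_
      rintro _ ⟨⟨S, rfl⟩, hYS, hZS⟩
      change Subgroup.centralizer _ ≤ _ at hYS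
      change Subgroup.centralizer _ ≤ _ at hZS
      rw [centralizer_gen_image] at hYS hZS
      rw [← centralizer_para]
      refine Subgroup.centralizer_le fun s hs => ?_
      rw [← centralizer_gen_image, SetLike.mem_coe, Subgroup.mem_centralizer_iff]
      rintro _ ⟨u, hu, rfl⟩
      have h1 : gen Γ u ∈ Subgroup.centralizer S :=
        hu.elim (fun h => hYS (gen_mem_para_iff.2 h)) fun h => hZS (gen_mem_para_iff.2 h)
      exact (Subgroup.mem_centralizer_iff.1 h1 s hs).symm
  · rintro _ ⟨Y, rfl⟩ _ ⟨Z, rfl⟩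
    refine ⟨Y ∪ Z, Subtype.ext (?_ : Subgroup.centralizer _ ⊓ Subgroup.centralizer _ =
      Subgroup.centralizer _)⟩
    rw [Set.image_union]
    ext g
    simp only [Subgroup.mem_inf, Subgroup.mem_centralizer_iff, Set.mem_union, or_imp, forall_and]

theorem perp_prefix {k : ℕ} (x : Fin k → V) (i : Fin (k + 1)) :
    perp Γ {v | ∃ j : Fin k, (j : ℕ) < (i : ℕ) ∧ v = x j} = prefixOrthogonal Γ x i := by
  ext v
  constructor
  · exact fun hv j hj => hv (x j) ⟨j, hj, rfl⟩
  · rintro hv _ ⟨j, hj, rfl⟩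
    exact hv j hj

theorem prefixCentraliser_eq {k : ℕ} (x : Fin k → V) (i : Fin (k + 1)) :
    prefixCentraliser Γ x i = para Γ (prefixOrthogonal Γ x i) := by
  have h1 : {g | ∃ j : Fin k, (j : ℕ) < (i : ℕ) ∧ g = gen Γ (x j)} =
      gen Γ '' {v | ∃ j : Fin k, (j : ℕ) < (i : ℕ) ∧ v = x j} := by
    ext g
    constructor
    · rintro ⟨j, hj, rfl⟩
      exact ⟨x j, ⟨j, hj, rfl⟩, rfl⟩
    · rintro ⟨_, ⟨j, hj, rfl⟩, rfl⟩
      exact ⟨j, hj, rfl⟩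
  rw [prefixCentraliser, h1, centralizer_gen_image, perp_prefix]

theorem strictAnti_prefixCentraliser_iff {k : ℕ} (x : Fin k → V) :
    StrictAnti (prefixCentraliser Γ x) ↔ StrictAnti (prefixOrthogonal Γ x) := by
  have h1 : ∀ Y Z : Set V, para Γ Y < para Γ Z ↔ Y < Z := fun Y Z => by
    simp only [lt_iff_le_not_ge, para_le_para_iff]
  simp only [StrictAnti, prefixCentraliser_eq, h1]

theorem prefixOrthogonal_zero {k : ℕ} (x : Fin k → V) : prefixOrthogonal Γ x 0 = Set.univ := by
  ext v
  simp [prefixOrthogonal]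

theorem prefixOrthogonal_cons {k : ℕ} (y : V) (x : Fin k → V) (i : Fin (k + 1)) :
    prefixOrthogonal Γ (Fin.cons y x : Fin (k + 1) → V) i.succ =
      perp Γ {y} ∩ prefixOrthogonal Γ x i := by
  ext v
  simp only [prefixOrthogonal, perp, Set.mem_inter_iff, Set.mem_ofPred_eq, Fin.forall_fin_succ,
    Fin.cons_zero, Fin.cons_succ, Fin.val_succ, Fin.val_zero, Nat.add_lt_add_iff_right]
  simp

theorem Desc.exists_strictAnti {Y : Set V} {k : ℕ} (h : Desc Γ Y k) :
    ∃ x : Fin k → V, StrictAnti fun i => Y ∩ prefixOrthogonal Γ x i := by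
  induction h with
  | zero Y => exact ⟨Fin.elim0, Subsingleton.strictAnti (α := Fin 1) _⟩
  | @succ Y k y r hr hry _ ih =>
    obtain ⟨x, hx⟩ := ih
    refine ⟨Fin.cons y x, Fin.strictAnti_iff_succ_lt.2 fun i => ?_⟩
    refine Fin.cases ?_ (fun i => ?_) i
    · rw [Fin.castSucc_zero, prefixOrthogonal_cons, prefixOrthogonal_zero, prefixOrthogonal_zero]
      exact ⟨fun v hv => ⟨hv.1, trivial⟩, fun hcon => hry (hcon ⟨hr, trivial⟩).2.1⟩
    · rw [← Fin.succ_castSucc, prefixOrthogonal_cons, prefixOrthogonal_cons, ← Set.inter_assoc,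
        ← Set.inter_assoc]
      exact hx i.castSucc_lt_succ

theorem exists_strictAnti_of_hasCentraliserChain [Finite V] {k : ℕ}
    (h : HasCentraliserChain (PCGroup Γ) k) :
    ∃ x : Fin k → V, StrictAnti (prefixOrthogonal Γ x) := by
  obtain ⟨C, hC⟩ := h
  -- The value `⊥` beyond `k` plays no role.
  have hchain : RelChain Γ Set.univ k fun i => if h : i < k + 1 then (C ⟨i, h⟩).1 else ⊥ := by
    refine ⟨fun i hi => ?_, fun i hi => ?_⟩
    · obtain ⟨S, hS⟩ := (C ⟨i, by omega⟩).2
      exact ⟨S, by rw [dif_pos (by omega), hS]; simp⟩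
    · rw [dif_pos (by omega), dif_pos (by omega)]
      exact hC (show (⟨i, by omega⟩ : Fin (k + 1)) < ⟨i + 1, by omega⟩ from Nat.lt_succ_self i)
  obtain ⟨x, hx⟩ := hchain.desc.exists_strictAnti
  exact ⟨x, by simpa using hx⟩

theorem prefixCentraliser_mem_canonical {k : ℕ} (x : Fin k → V) (i : Fin (k + 1)) :
    ∃ C ∈ canonicalCentralisers Γ, C.1 = prefixCentraliser Γ x i := by
  refine ⟨_, ⟨{v | ∃ j : Fin k, (j : ℕ) < (i : ℕ) ∧ v = x j}, rfl⟩, ?_⟩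
  rw [prefixCentraliser_eq]
  change Subgroup.centralizer _ = _
  rw [centralizer_gen_image, perp_prefix]

theorem exists_canonical_chain {k : ℕ} {x : Fin k → V} (hx : StrictAnti (prefixCentraliser Γ x)) :
    ∃ C : Fin (k + 1) → canonicalCentralisers Γ, StrictAnti C := by
  choose C hC hCx using prefixCentraliser_mem_canonical (Γ := Γ) x
  refine ⟨fun i => ⟨C i, hC i⟩, fun i j hij => ?_⟩
  change (C j).1 < (C i).1
  rw [hCx, hCx]
  exact hx hij

/-- A longest chain of centralisers of initial segments of a sequence of vertices ends with the
centre. -/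
theorem prefixCentraliser_last_eq_center {d : ℕ} {x : Fin d → V}
    (hx : StrictAnti (prefixOrthogonal Γ x))
    (hmax : ∀ y : Fin (d + 1) → V, ¬ StrictAnti (prefixOrthogonal Γ y)) :
    prefixCentraliser Γ x (Fin.last d) = Subgroup.center (PCGroup Γ) := by
  have hlast : ∀ v ∈ prefixOrthogonal Γ x (Fin.last d), ∀ y, v = y ∨ Γ.Adj v y := by
    intro v hv y
    by_contra hvy
    -- Appending `y` would remove `v` and so lengthen the sequence.
    refine hmax (Fin.snoc x y) (Fin.strictAnti_iff_succ_lt.2 fun i => ?_)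
    have hsnoc : ∀ i : Fin (d + 1), prefixOrthogonal Γ (Fin.snoc x y : Fin (d + 1) → V)
        i.castSucc = prefixOrthogonal Γ x i := by
      intro i
      ext w
      simp only [prefixOrthogonal, Set.mem_ofPred_eq, Fin.forall_fin_succ', Fin.snoc_castSucc,
        Fin.val_castSucc, Fin.snoc_last, Fin.val_last, and_iff_left_iff_imp]
      intro _ h
      omega
    refine Fin.lastCases ?_ (fun i => ?_) i
    · refine ⟨fun w hw j hj => hw j (by simp at hj ⊢; omega), fun hcon => hvy ?_⟩
      have h1 := hcon (hsnoc (Fin.last d) ▸ hv) (Fin.last d) (by simp)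
      simpa using h1
    · rw [Fin.succ_castSucc, hsnoc, hsnoc]
      exact hx i.castSucc_lt_succ
  have hcenter : Subgroup.center (PCGroup Γ) = para Γ (perp Γ Set.univ) := by
    rw [← centralizer_gen_image, ← centralizer_para, para_univ, Subgroup.coe_top,
      Subgroup.centralizer_univ]
  rw [prefixCentraliser_eq, hcenter]
  congr 1
  ext v
  exact ⟨fun hv y _ => hlast v hv y, fun hv j _ => hv _ trivial⟩

end PCGroup

open PCGroup in
theorem theorem3p2 {V : Type*} [Finite V] (Γ : SimpleGraph V) :
    -- The canonical centralisers form a sublattice of the centraliser lattice,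
    IsSublattice (canonicalCentralisers Γ) ∧
    -- whose height is the centraliser dimension of the group;
    ((cdim (PCGroup Γ) : ℕ∞) : WithBot ℕ∞) = Order.krullDim (canonicalCentralisers Γ) ∧
    ∃ d : ℕ, cdim (PCGroup Γ) = d ∧
      -- this is finite, and attained by a chain `G > C(x₁) > ⋯ > C(x₁, …, x_d) = Z(G)`,
      (∃ x : Fin d → V, StrictAnti (prefixCentraliser Γ x) ∧
        prefixCentraliser Γ x (Fin.last d) = Subgroup.center (PCGroup Γ)) ∧
      -- which is a longest one of this form;
      IsGreatest {k : ℕ | ∃ x : Fin k → V, StrictAnti (prefixCentraliser Γ x)} d ∧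
      -- and it can be read off from the graph.
      IsGreatest {k : ℕ | ∃ x : Fin k → V, StrictAnti (prefixOrthogonal Γ x)} d := by
  obtain ⟨d, ⟨x, hx⟩, hmax⟩ :
      ∃ d, IsGreatest {k : ℕ | ∃ x : Fin k → V, StrictAnti (prefixOrthogonal Γ x)} d := by
    refine ⟨_, Nat.sSup_mem ⟨0, Fin.elim0, Subsingleton.strictAnti (α := Fin 1) _⟩ ?_,
      fun k hk => le_csSup ?_ hk⟩ <;>
    -- The `k + 1` sets of a strict sequence are distinct subsets of `V`.
    · refine ⟨Nat.card (Set V), ?_⟩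
      rintro k ⟨x, hx⟩
      have := Nat.card_le_card_of_injective _ hx.injective
      simp only [Nat.card_eq_fintype_card, Fintype.card_fin] at this
      omega
  have hx' := (strictAnti_prefixCentraliser_iff x).2 hx
  obtain ⟨C, hC⟩ := exists_canonical_chain hx'
  have hcdim : cdim (PCGroup Γ) = d := by
    refine le_antisymm (iSup₂_le fun k hk => ?_) (le_iSup₂ (f := fun (k : ℕ)
      (_ : HasCentraliserChain (PCGroup Γ) k) => (k : ℕ∞)) d ⟨fun i => (C i).1, hC⟩)
    exact_mod_cast hmax (exists_strictAnti_of_hasCentraliserChain hk)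
  refine ⟨isSublattice_canonicalCentralisers Γ, ?_, d, hcdim, ⟨x, hx', ?_⟩, ?_, ⟨x, hx⟩, hmax⟩
  · rw [hcdim]
    refine le_antisymm ?_ (iSup_le fun p => ?_)
    -- The Krull dimension uses ascending series, hence the reversal.
    · exact Order.LTSeries.length_le_krullDim (LTSeries.mk d (fun i => C i.rev)
        fun i j hij => hC (Fin.rev_lt_rev.2 hij))
    · have h1 : HasCentraliserChain (PCGroup Γ) p.length :=
        ⟨fun i => (p i.rev).1, fun i j hij => p.strictMono (Fin.rev_lt_rev.2 hij)⟩
      exact_mod_cast hmax (exists_strictAnti_of_hasCentraliserChain h1)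
  · refine prefixCentraliser_last_eq_center hx fun y hy => ?_
    exact absurd (hmax ⟨y, hy⟩) (by omega)
  · simp only [strictAnti_prefixCentraliser_iff]
    exact ⟨⟨x, hx⟩, hmax⟩
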